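/- Let $k\ge 3$ be an integer. A $k$-partite $k$-graph $H$ is a hypergraph whose vertex set is partitioned into classes $V_1,\dots,V_k$ such that every edge meets every $V_i$ in exactly one vertex. A set $S$ of vertices is legal if $|S\cap V_i|\le 1$ for all $i$. The minimum co-degree $\delta_{k-1}(H)$ is the minimum, over all legal $(k-1)$-sets $S$, of the number of vertices $v$ such that $S\cup\{v\}$ is an edge; $\nu(H)$ is the maximum number of pairwise disjoint edges of $H$. (i) There is an integer $n_0=n_0(k)$ such that for every $n\ge n_0$ and every $k$-partite $k$-graph $H$ with $n$ vertices in each partition class, if $\delta_{k-1}(H)\ge n/k$, then $\nu(H)\ge n-1$. (ii) The bound $n/k$ in (i) is best possible when $n\not\equiv 1\pmod k$: for every $n\ge 1$ with $n\not\equiv 1 \pmod k$ there is a $k$-partite $k$-graph $H$ with $n$ vertices in each partition class such that $\delta_{k-1}(H)\ge\lfloor (n-1)/k\rfloor$ (the largest integer smaller than $n/k$) and $\nu(H)<n-1$. -/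

import Mathlib

namespace Hypergraph

variable {α : Type*}

/-- `H` is a `k`-partite `k`-graph with partition classes `P 0, ..., P (k-1)`: the classes
partition the vertex set and every edge meets every class in exactly one vertex (so every edge
has exactly `k` vertices). -/
structure IsPartiteWith {k : ℕ} (H : Hypergraph α) (P : Fin k → Set α) : Prop where
  disjoint : ∀ i j, i ≠ j → Disjoint (P i) (P j)
  iUnion_eq : ⋃ i, P i = H.vertexSet
  encard_inter : ∀ e ∈ H.edgeSet, ∀ i, (e ∩ P i).encard = 1

/-- A set of vertices is legal if it has at most one vertex in each partition class. -/
def IsLegal {k : ℕ} (H : Hypergraph α) (P : Fin k → Set α) (S : Set α) : Prop :=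
  S ⊆ H.vertexSet ∧ ∀ i, (S ∩ P i).encard ≤ 1

/-- The neighborhood of `S` in a `k`-graph `H`: all sets `U` of `k - |S|` vertices such that
`S ∪ U` is an edge. -/
def neighborhood (H : Hypergraph α) (k : ℕ) (S : Set α) : Set (Set α) :=
  {U | U ⊆ H.vertexSet ∧ S.encard + U.encard = k ∧ S ∪ U ∈ H.edgeSet}

/-- The degree of `S` in a `k`-graph `H`. -/
noncomputable def setDegree (H : Hypergraph α) (k : ℕ) (S : Set α) : ℕ :=
  (H.neighborhood k S).ncard

/-- The minimum `l`-degree of a `k`-partite `k`-graph `H` with partition classes `P`: the minimum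
of the degrees of the legal sets with `l` vertices. -/
noncomputable def minDegree {k : ℕ} (H : Hypergraph α) (P : Fin k → Set α) (l : ℕ) : ℕ :=
  sInf {d | ∃ S : Set α, H.IsLegal P S ∧ S.encard = l ∧ H.setDegree k S = d}

/-- The minimum co-degree of a `k`-partite `k`-graph, that is, its minimum `(k-1)`-degree. -/
noncomputable def minCodegree {k : ℕ} (H : Hypergraph α) (P : Fin k → Set α) : ℕ :=
  H.minDegree P (k - 1)

/-- A matching is a set of pairwise disjoint edges. -/
def IsMatching (H : Hypergraph α) (M : Set (Set α)) : Prop :=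
  M ⊆ H.edgeSet ∧ ∀ e ∈ M, ∀ f ∈ M, e ≠ f → Disjoint e f

/-- The maximum size of a matching in a (finite) hypergraph. -/
noncomputable def matchingNumber (H : Hypergraph α) : ℕ :=
  sSup {m | ∃ M : Set (Set α), H.IsMatching M ∧ M.encard = m}

end Hypergraph

/-! Identify every class with one set `V` of size n: edges become tuples, and disjoint means
different in every coordinate. Part (i) combines absorption with stability.

A constant proportion of all tuples absorbs any given pair of disjoint tuples (`card_absorbs`), so a
matching `F`, of size a small multiple of n, contains k² absorbers of every pair
(`exists_absorbing`). Let M be a maximum matching avoiding `F`. If `F` and M together miss at most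
k² + 1 vertices per class, absorption, which trades one edge for two, brings this down to at most
one (`exists_large_of_absorbing`).

Otherwise M leaves many disjoint tuples uncovered. No edge of M can complete two disjoint leftover
tuples in two different coordinates, while each leftover tuple is completed by about n/k edges of M
in each coordinate. Hence these sets of edges nearly partition M, and swapping edges shows that H
resembles the space barrier: there are sets `A i` of size about n/k, with nearly all other vertices
in `G i`, such that tuples in `G` are completed almost only by `A` (`exists_extremal_partition`).
Such a graph is handled directly (`IsExtremal.exists_matching`): a small matching covers the
exceptional vertices and balances `A` against the number of edges still needed, and all but one
vertex per class of the rest splits into k dense blocks with perfect matchings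
(`exists_perfect_matching`).

For part (ii), let every edge meet a set with a = ⌊(n-1)/k⌋ vertices in each class. Then a matching
has at most ka edges, and ka < n - 1 unless k divides n - 1. -/

namespace KPartite

set_option linter.unusedSectionVars false

open Finset Function

/-! ### Tuples, matchings, and exchanges at a maximum matching. -/

section

variable {k : ℕ} {V : Type*} [Fintype V] [DecidableEq V]

/-- The vertices `v` of class `i` which complete the tuple `f`, with its `i`-th entry ignored,
to an edge. -/
def nbr (E : Finset (Fin k → V)) (i : Fin k) (f : Fin k → V) : Finset V :=
  {v | update f i v ∈ E}

/-- `M` is a set of pairwise disjoint edges of `E` inside the vertex classes `Z i`. -/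
structure IsMatch (E : Finset (Fin k → V)) (Z : Fin k → Finset V)
    (M : Finset (Fin k → V)) : Prop where
  sub : M ⊆ E
  mem : ∀ f ∈ M, ∀ i, f i ∈ Z i
  inj : ∀ f ∈ M, ∀ g ∈ M, ∀ i, f i = g i → f = g

/-- The vertices of class `i` covered by `M`. -/
def cov (M : Finset (Fin k → V)) (i : Fin k) : Finset V := M.image (fun f => f i)

variable {E : Finset (Fin k → V)} {Z : Fin k → Finset V} {M N : Finset (Fin k → V)}

@[simp] lemma mem_nbr {i : Fin k} {f : Fin k → V} {v : V} :
    v ∈ nbr E i f ↔ update f i v ∈ E := by simp [nbr]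

lemma mem_cov {i : Fin k} {v : V} : v ∈ cov M i ↔ ∃ f ∈ M, f i = v := by simp [cov]

lemma cov_mem {i : Fin k} {f : Fin k → V} (hf : f ∈ M) : f i ∈ cov M i :=
  mem_cov.2 ⟨f, hf, rfl⟩

lemma card_cov (h : IsMatch E Z M) (i : Fin k) : (cov M i).card = M.card :=
  card_image_of_injOn fun f hf g hg hfg => h.inj f hf g hg i hfg

lemma card_cov_le (M : Finset (Fin k → V)) (i : Fin k) : (cov M i).card ≤ M.card :=
  card_image_le

lemma IsMatch.subset (h : IsMatch E Z M) (hN : N ⊆ M) : IsMatch E Z N :=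
  ⟨hN.trans h.sub, fun f hf => h.mem f (hN hf), fun f hf g hg => h.inj f (hN hf) g (hN hg)⟩

lemma IsMatch.mono {Z' : Fin k → Finset V} (h : IsMatch E Z M) (hZ : ∀ i, Z i ⊆ Z' i) :
    IsMatch E Z' M :=
  ⟨h.sub, fun f hf i => hZ i (h.mem f hf i), h.inj⟩

lemma isMatch_empty : IsMatch E Z ∅ := ⟨by simp, by simp, by simp⟩

lemma IsMatch.union (hM : IsMatch E Z M) (hN : IsMatch E Z N)
    (hd : ∀ f ∈ M, ∀ g ∈ N, ∀ i, f i ≠ g i) : IsMatch E Z (M ∪ N) := by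
  refine ⟨union_subset hM.sub hN.sub, ?_, ?_⟩
  · intro f hf i
    rcases mem_union.1 hf with hf | hf
    exacts [hM.mem f hf i, hN.mem f hf i]
  · intro f hf g hg i hfg
    rcases mem_union.1 hf with hf | hf <;> rcases mem_union.1 hg with hg | hg
    · exact hM.inj f hf g hg i hfg
    · exact absurd hfg (hd f hf g hg i)
    · exact absurd hfg.symm (hd g hg f hf i)
    · exact hN.inj f hf g hg i hfg

lemma card_union_of_ne [NeZero k] (hd : ∀ f ∈ M, ∀ g ∈ N, ∀ i, f i ≠ g i) :
    (M ∪ N).card = M.card + N.card :=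
  card_union_of_disjoint (disjoint_left.2 fun f hf hf' => hd f hf f hf' 0 rfl)

lemma isMatch_singleton {f : Fin k → V} (hf : f ∈ E) (hZ : ∀ i, f i ∈ Z i) :
    IsMatch E Z {f} :=
  ⟨by simpa using hf, by simpa using hZ, by simp⟩

lemma isMatch_pair {f g : Fin k → V} (hf : f ∈ E) (hg : g ∈ E) (hfZ : ∀ i, f i ∈ Z i)
    (hgZ : ∀ i, g i ∈ Z i) (hfg : ∀ i, f i ≠ g i) : IsMatch E Z {f, g} := by
  have := (isMatch_singleton hf hfZ).union (isMatch_singleton hg hgZ) (by simpa using hfg)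
  rwa [← insert_eq] at this

lemma IsMatch.insert {f : Fin k → V} (hM : IsMatch E Z M) (hf : f ∈ E) (hZ : ∀ i, f i ∈ Z i)
    (hc : ∀ i, f i ∉ cov M i) : IsMatch E Z (insert f M) := by
  rw [insert_eq]
  refine (isMatch_singleton hf hZ).union hM ?_
  simp only [mem_singleton, forall_eq]
  exact fun g hg i h => hc i (mem_cov.2 ⟨g, hg, h.symm⟩)

lemma notMem_of_cov [NeZero k] {f : Fin k → V} (hc : ∀ i, f i ∉ cov M i) : f ∉ M :=
  fun h => hc 0 (cov_mem h)

/-- `M` is a matching of maximum size inside `Z`. -/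
def IsMaxMatch (E : Finset (Fin k → V)) (Z : Fin k → Finset V) (M : Finset (Fin k → V)) : Prop :=
  IsMatch E Z M ∧ ∀ N, IsMatch E Z N → N.card ≤ M.card

lemma exists_isMaxMatch (E : Finset (Fin k → V)) (Z : Fin k → Finset V) :
    ∃ M, IsMaxMatch E Z M := by
  classical
  obtain ⟨M, hM, hmax⟩ := exists_max_image (E.powerset.filter (IsMatch E Z)) card
    ⟨∅, by simp [isMatch_empty]⟩
  rw [mem_filter] at hM
  exact ⟨M, hM.2, fun N hN => hmax N (by simp [hN, hN.sub])⟩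

lemma IsMaxMatch.notMem_of_leftover [NeZero k] (h : IsMaxMatch E Z M) {Q : Fin k → V} {i : Fin k}
    {v : V} (hQ : ∀ l, l ≠ i → Q l ∈ Z l \ cov M l) (hv : v ∈ Z i \ cov M i) :
    update Q i v ∉ E := by
  intro hE
  have key : ∀ l, update Q i v l ∈ Z l \ cov M l := by
    intro l
    by_cases hl : l = i
    · subst hl; simpa using hv
    · simpa [hl] using hQ l hl
  have h1 := h.2 _ (h.1.insert hE (fun l => (mem_sdiff.1 (key l)).1)
    (fun l => (mem_sdiff.1 (key l)).2))
  rw [card_insert_of_notMem (notMem_of_cov fun l => (mem_sdiff.1 (key l)).2)] at h1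
  omega

/-- Otherwise `e` could be traded for both completed tuples: in coordinates `i` and `j` one of them
uses `e` and the other a leftover vertex, and elsewhere `Q` and `Q'` differ. This exchange drives
the stability argument. -/
lemma IsMaxMatch.not_two_of_leftover [NeZero k] (h : IsMaxMatch E Z M) {Q Q' : Fin k → V}
    {i j : Fin k} (hij : i ≠ j) (hQ : ∀ l, l ≠ i → Q l ∈ Z l \ cov M l)
    (hQ' : ∀ l, l ≠ j → Q' l ∈ Z l \ cov M l) (hne : ∀ l, l ≠ i → l ≠ j → Q l ≠ Q' l)
    {e : Fin k → V} (he : e ∈ M) (h1 : update Q i (e i) ∈ E) : update Q' j (e j) ∉ E := by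
  intro h2
  have hcov : ∀ l, cov (M.erase e) l ⊆ cov M l := fun l => image_subset_image (erase_subset _ _)
  have hee : ∀ l, e l ∉ cov (M.erase e) l := by
    intro l hl
    obtain ⟨g, hg, hgl⟩ := mem_cov.1 hl
    exact (mem_erase.1 hg).1 (h.1.inj g (mem_erase.1 hg).2 e he l hgl)
  have keyZ : ∀ (R : Fin k → V) (a : Fin k), (∀ l, l ≠ a → R l ∈ Z l \ cov M l) →
      ∀ l, update R a (e a) l ∈ Z l ∧ update R a (e a) l ∉ cov (M.erase e) l := by
    intro R a hR l
    by_cases hl : l = a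
    · subst hl; simpa using ⟨h.1.mem e he l, hee l⟩
    · have := mem_sdiff.1 (hR l hl)
      simpa [hl] using ⟨this.1, fun h' => this.2 (hcov l h')⟩
  have hd : ∀ l, update Q i (e i) l ≠ update Q' j (e j) l := by
    intro l
    by_cases hl : l = i
    · subst hl
      simp only [update_self, update_of_ne hij]
      intro h'
      exact (mem_sdiff.1 (hQ' l hij)).2 (h' ▸ cov_mem he)
    · by_cases hl' : l = j
      · subst hl'
        simp only [update_self, update_of_ne hl]
        intro h'
        exact (mem_sdiff.1 (hQ l hl)).2 (h' ▸ cov_mem he)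
      · simpa [hl, hl'] using hne l hl hl'
  have hdis : ∀ f ∈ M.erase e, ∀ g ∈ ({update Q i (e i), update Q' j (e j)} : Finset (Fin k → V)),
      ∀ l, f l ≠ g l := by
    intro f hf g hg l hfg
    have hc : g l ∈ cov (M.erase e) l := hfg ▸ cov_mem hf
    rcases mem_insert.1 hg with rfl | hg
    · exact (keyZ Q i hQ l).2 hc
    · rw [mem_singleton] at hg; subst hg
      exact (keyZ Q' j hQ' l).2 hc
  have hU := (h.1.subset (erase_subset e M)).union (isMatch_pair h1 h2
    (fun l => (keyZ Q i hQ l).1) (fun l => (keyZ Q' j hQ' l).1) hd) hdis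
  have hc := h.2 _ hU
  rw [card_union_of_ne hdis, card_erase_of_mem he, card_pair (fun h' => hd 0 (congrFun h' 0))] at hc
  have := card_pos.2 ⟨e, he⟩
  omega

/-- The edges of `M` whose `i`-th vertex completes `Q` to an edge. -/
def hit (E M : Finset (Fin k → V)) (i : Fin k) (Q : Fin k → V) : Finset (Fin k → V) :=
  M.filter fun e => update Q i (e i) ∈ E

lemma mem_hit {i : Fin k} {Q e : Fin k → V} : e ∈ hit E M i Q ↔ e ∈ M ∧ update Q i (e i) ∈ E := by
  simp [hit]

lemma IsMaxMatch.card_nbr_le [NeZero k] (h : IsMaxMatch E Z M) {Q : Fin k → V} {i : Fin k}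
    (hQ : ∀ l, l ≠ i → Q l ∈ Z l \ cov M l) :
    (nbr E i Q ∩ Z i).card ≤ (hit E M i Q).card := by
  refine (card_le_card (t := (hit E M i Q).image (fun e => e i)) ?_).trans card_image_le
  intro v hv
  rw [mem_inter, mem_nbr] at hv
  by_contra hcon
  refine h.notMem_of_leftover hQ (v := v) (mem_sdiff.2 ⟨hv.2, fun hc => hcon ?_⟩) hv.1
  obtain ⟨f, hf, rfl⟩ := mem_cov.1 hc
  exact mem_image.2 ⟨f, mem_hit.2 ⟨hf, hv.1⟩, rfl⟩

lemma IsMaxMatch.disjoint_hit [NeZero k] (h : IsMaxMatch E Z M) {Q Q' : Fin k → V}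
    {i j : Fin k} (hij : i ≠ j) (hQ : ∀ l, l ≠ i → Q l ∈ Z l \ cov M l)
    (hQ' : ∀ l, l ≠ j → Q' l ∈ Z l \ cov M l) (hne : ∀ l, l ≠ i → l ≠ j → Q l ≠ Q' l) :
    Disjoint (hit E M i Q) (hit E M j Q') :=
  disjoint_left.2 fun _ he he' =>
    h.not_two_of_leftover hij hQ hQ' hne (mem_hit.1 he).1 (mem_hit.1 he).2 (mem_hit.1 he').2

lemma exists_disjoint_family {J : Type*} [Fintype J] (U : Fin k → Finset V)
    (hU : ∀ i, Fintype.card J ≤ (U i).card) :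
    ∃ S : J → Fin k → V, (∀ x i, S x i ∈ U i) ∧ ∀ x y i, S x i = S y i → x = y := by
  have : ∀ i, Nonempty (J ↪ U i) := fun i =>
    Embedding.nonempty_of_card_le (by simpa using hU i)
  exact ⟨fun x i => (this i).some x, fun x i => ((this i).some x).2,
    fun x y i h => (this i).some.injective (Subtype.ext h)⟩

/-! ### Absorption. -/

/-- If `S` does not depend on coordinate `i`, then restricting this coordinate to sets `C f` of
density at least `1 / c` keeps a proportion at least `1 / c` of `S`. -/
lemma card_le_mul_card_filter (hV : 0 < Fintype.card V) (S : Finset (Fin k → V)) (i : Fin k)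
    (c : ℕ) (hS : ∀ f ∈ S, ∀ v, update f i v ∈ S) (C : (Fin k → V) → Finset V)
    (hC : ∀ f v, C (update f i v) = C f) (hc : ∀ f ∈ S, Fintype.card V ≤ c * (C f).card) :
    S.card ≤ c * (S.filter fun f => f i ∈ C f).card := by
  -- Exchange `v` with the `i`-th entry of `f` and record the old entry; nothing is lost.
  have h1 : (S.sigma C).card ≤ ((S.filter fun f => f i ∈ C f) ×ˢ (univ : Finset V)).card := by
    refine card_le_card_of_injOn (fun x => (update x.1 i x.2, x.1 i)) ?_ ?_
    · rintro ⟨f, v⟩ hx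
      simp only [coe_sigma, Set.mem_sigma_iff, mem_coe] at hx
      simp only [coe_product, Set.mem_prod, mem_coe, mem_filter, mem_univ, and_true,
        update_self, hC]
      exact ⟨hS f hx.1 v, hx.2⟩
    · rintro ⟨f, v⟩ hx ⟨g, w⟩ hy hxy
      simp only [Prod.mk.injEq] at hxy
      obtain ⟨h1, h2⟩ := hxy
      have hvw : v = w := by simpa using congrFun h1 i
      have hfg : f = g := by
        ext l
        by_cases hl : l = i
        · rw [hl]; exact h2
        · simpa [hl] using congrFun h1 l
      subst hvw hfg; rfl
  rw [card_sigma, card_product, card_univ] at h1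
  refine Nat.le_of_mul_le_mul_right ?_ hV
  calc S.card * Fintype.card V = ∑ f ∈ S, Fintype.card V := by simp
    _ ≤ ∑ f ∈ S, c * (C f).card := sum_le_sum hc
    _ = c * ∑ f ∈ S, (C f).card := by rw [mul_sum]
    _ ≤ c * ((S.filter fun f => f i ∈ C f).card * Fintype.card V) := Nat.mul_le_mul_left _ h1
    _ = _ := by ring

lemma card_filter_coord_mem (i : Fin k) (W : Finset V) :
    (univ.filter fun f : Fin k → V => f i ∈ W).card = W.card * Fintype.card V ^ (k - 1) := by
  have : (univ.filter fun f : Fin k → V => f i ∈ W) =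
      Fintype.piFinset (update (fun _ => (univ : Finset V)) i W) := by
    ext f
    simp only [mem_filter, mem_univ, true_and, Fintype.mem_piFinset]
    constructor
    · intro h l
      by_cases hl : l = i
      · subst hl; simpa using h
      · simp [hl]
    · intro h; simpa using h i
  rw [this, Fintype.card_piFinset]
  have h2 : ∀ l, (update (fun _ => (univ : Finset V)) i W l).card =
      update (fun _ => Fintype.card V) i W.card l := by
    intro l
    by_cases hl : l = i
    · subst hl; simp
    · simp [hl]
  rw [prod_congr rfl fun l _ => h2 l, prod_update_of_mem (mem_univ i)]
  simp [card_sdiff]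

/-- The edge `e` absorbs the pair of tuples `Q, Q'` if `e`, `Q`, `Q'` together contain two
disjoint edges. -/
def Absorbs (E : Finset (Fin k → V)) (Q Q' e : Fin k → V) : Prop :=
  e ∈ E ∧ (∀ i, e i ≠ Q i ∧ e i ≠ Q' i) ∧ ∃ f ∈ E, ∃ g ∈ E, ∀ i, f i ≠ g i ∧
    (f i = e i ∨ f i = Q i ∨ f i = Q' i) ∧ (g i = e i ∨ g i = Q i ∨ g i = Q' i)

open Classical in
-- The two new edges are `Q` with its entry 0 taken from `e`, and `e` with its entries 0 and 1 taken
-- from `Q'`. The vertex of `e` in coordinate 1 occurs in neither, so it stays free to make `e`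
-- itself an edge. Choosing entries 0, 2, 1 of `e` in this order costs a factor k each; this is
-- where three coordinates are needed.
lemma card_absorbs (hk : 3 ≤ k) (hd : ∀ i f, Fintype.card V ≤ k * (nbr E i f).card)
    {Q Q' : Fin k → V} (hQ : ∀ i, Q i ≠ Q' i) (W : Fin k → Finset V) (w : ℕ)
    (hW : ∀ i, (W i).card ≤ w) (hn : 2 * k ^ 4 * (w + 2) ≤ Fintype.card V) :
    Fintype.card V ^ k ≤
      2 * k ^ 3 * (univ.filter fun e => Absorbs E Q Q' e ∧ ∀ i, e i ∉ W i).card := by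
  set n := Fintype.card V with hnd
  have hn0 : 0 < n := lt_of_lt_of_le (by positivity) hn
  let i0 : Fin k := ⟨0, by omega⟩
  let i1 : Fin k := ⟨1, by omega⟩
  let i2 : Fin k := ⟨2, by omega⟩
  have h01 : i0 ≠ i1 := by simp [i0, i1]
  have h02 : i0 ≠ i2 := by simp [i0, i2]
  have h12 : i1 ≠ i2 := by simp [i1, i2]
  let S1 : Finset (Fin k → V) := univ.filter fun e => e i0 ∈ nbr E i0 Q
  let C2 : (Fin k → V) → Finset V :=
    fun e => nbr E i2 (update (update e i0 (Q' i0)) i1 (Q' i1))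
  let S2 : Finset (Fin k → V) := S1.filter fun e => e i2 ∈ C2 e
  let S3 : Finset (Fin k → V) := S2.filter fun e => e i1 ∈ nbr E i1 e
  have hnbr : ∀ (i : Fin k) f v, nbr E i (update f i v) = nbr E i f := by
    intro i f v; ext; simp
  have hc1 : n ^ k ≤ k * S1.card := by
    have := card_le_mul_card_filter hn0 (univ : Finset (Fin k → V)) i0 k (by simp)
      (fun _ => nbr E i0 Q) (by simp) (fun f _ => hd i0 Q)
    simpa [S1, ← hnd] using this
  have hc2 : S1.card ≤ k * S2.card := by
    refine card_le_mul_card_filter hn0 S1 i2 k ?_ C2 ?_ (fun f _ => hd _ _)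
    · intro f hf v
      simpa [S1, h02] using hf
    · intro f v
      simp only [C2]
      rw [update_comm h02.symm, update_comm h12.symm, hnbr]
  have hc3 : S2.card ≤ k * S3.card := by
    refine card_le_mul_card_filter hn0 S2 i1 k ?_ _ (fun f v => hnbr i1 f v) (fun f _ => hd _ _)
    intro f hf v
    simp only [S2, S1, C2, mem_filter, mem_univ, true_and, mem_nbr] at hf ⊢
    rw [update_of_ne h01, update_of_ne h12.symm, update_comm h01.symm, update_idem]
    exact hf
  set T := univ.filter fun e => Absorbs E Q Q' e ∧ ∀ i, e i ∉ W i with hT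
  have hcover : S3 ⊆ T ∪ univ.biUnion fun i : Fin k =>
      univ.filter fun e : Fin k → V => e i ∈ W i ∪ {Q i, Q' i} := by
    intro e he
    rw [mem_union]
    by_cases hbad : ∃ i, e i ∈ W i ∪ {Q i, Q' i}
    · obtain ⟨i, hi⟩ := hbad
      exact Or.inr (mem_biUnion.2 ⟨i, mem_univ _, mem_filter.2 ⟨mem_univ _, hi⟩⟩)
    · left
      push Not at hbad
      simp only [mem_union, mem_insert, mem_singleton, not_or] at hbad
      simp only [S3, S2, S1, C2, mem_filter, mem_univ, true_and, mem_nbr, update_eq_self] at he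
      obtain ⟨⟨he0, he2⟩, he1⟩ := he
      rw [hT, mem_filter]
      refine ⟨mem_univ _, ⟨he1, fun i => (hbad i).2, _, he0, _, he2, ?_⟩, fun i => (hbad i).1⟩
      intro i
      by_cases hi0 : i = i0
      · subst hi0
        simp [h01, h02, (hbad i0).2.2]
      · by_cases hi1 : i = i1
        · subst hi1
          simp [h01.symm, h12, hQ]
        · by_cases hi2 : i = i2
          · subst hi2
            simp [h02.symm, Ne.symm (hbad i2).2.1]
          · simp [hi0, hi1, hi2, Ne.symm (hbad i).2.1]
  -- Tuples meeting `W`, `Q` or `Q'` are of lower order; by `hn` they take at most half of the n^k /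
  -- k³ tuples found.
  have hbadc : (univ.biUnion fun i : Fin k =>
      univ.filter fun e : Fin k → V => e i ∈ W i ∪ {Q i, Q' i}).card ≤
      k * ((w + 2) * n ^ (k - 1)) := by
    refine card_biUnion_le.trans ?_
    calc _ ≤ ∑ _i : Fin k, (w + 2) * n ^ (k - 1) := by
          refine sum_le_sum fun i _ => ?_
          rw [card_filter_coord_mem]
          refine Nat.mul_le_mul_right _ ((card_union_le _ _).trans ?_)
          exact Nat.add_le_add (hW i) card_le_two
      _ = _ := by simp
  have h4 := (card_le_card hcover).trans (card_union_le _ _)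
  have hpow : n ^ k = n * n ^ (k - 1) := by
    rw [← pow_succ']; congr 1; omega
  have h5 : 2 * k ^ 4 * (w + 2) * n ^ (k - 1) ≤ n ^ k := by
    rw [hpow]; exact Nat.mul_le_mul_right _ hn
  have h6 : n ^ k ≤ k * (k * (k * S3.card)) :=
    hc1.trans (Nat.mul_le_mul_left _ (hc2.trans (Nat.mul_le_mul_left _ hc3)))
  have h7 : n ^ k ≤ k ^ 3 * (T.card + k * ((w + 2) * n ^ (k - 1))) := by
    calc n ^ k ≤ k ^ 3 * S3.card := by rw [pow_three]; simpa [mul_assoc] using h6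
      _ ≤ _ := Nat.mul_le_mul_left _ (h4.trans (Nat.add_le_add_left hbadc _))
  have h8 : k ^ 3 * (T.card + k * ((w + 2) * n ^ (k - 1))) =
      k ^ 3 * T.card + k ^ 4 * (w + 2) * n ^ (k - 1) := by ring
  have h9 : 2 * k ^ 4 * (w + 2) * n ^ (k - 1) = 2 * (k ^ 4 * (w + 2) * n ^ (k - 1)) := by ring
  have h10 : 2 * k ^ 3 * T.card = 2 * (k ^ 3 * T.card) := by ring
  rw [h10]
  rw [h8] at h7
  rw [h9] at h5
  omega

open Classical in
/-- The pairs of disjoint tuples which no edge of `F` absorbs. -/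
noncomputable def unabsorbed (E F : Finset (Fin k → V)) :
    Finset ((Fin k → V) × (Fin k → V)) :=
  univ.filter fun u => (∀ i, u.1 i ≠ u.2 i) ∧ ∀ e ∈ F, ¬ Absorbs E u.1 u.2 e

open Classical in
lemma exists_few_unabsorbed [NeZero k] (hk : 3 ≤ k)
    (hd : ∀ i f, Fintype.card V ≤ k * (nbr E i f).card)
    (W : Fin k → Finset V) (w : ℕ) (hW : ∀ i, (W i).card ≤ w) (t : ℕ)
    (hn : 2 * k ^ 4 * (w + t + 2) ≤ Fintype.card V) :
    ∃ F, IsMatch E (fun i => (W i)ᶜ) F ∧ F.card ≤ t ∧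
      (2 * k ^ 3) ^ t * (unabsorbed E F).card ≤
        (2 * k ^ 3 - 1) ^ t * (Fintype.card V ^ k * Fintype.card V ^ k) := by
  induction t with
  | zero =>
    refine ⟨∅, isMatch_empty, by simp, ?_⟩
    simpa using card_le_univ (unabsorbed E (∅ : Finset (Fin k → V)))
  | succ t ih =>
    obtain ⟨F, hF, hFt, hFc⟩ := ih (le_trans (Nat.mul_le_mul_left _ (by omega)) hn)
    set n := Fintype.card V with hnd
    have hn0 : 0 < n := lt_of_lt_of_le (by positivity) hn
    set q := 2 * k ^ 3 with hq
    have hq1 : 1 ≤ q := by rw [hq]; have : 0 < k ^ 3 := by positivity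
                           omega
    set R := unabsorbed E F with hR
    let good : (Fin k → V) → Prop := fun e => ∀ i, e i ∉ W i ∪ cov F i
    let ab : (Fin k → V) → Finset ((Fin k → V) × (Fin k → V)) :=
      fun e => R.filter fun u => Absorbs E u.1 u.2 e
    have hW' : ∀ i, (W i ∪ cov F i).card ≤ w + t := fun i =>
      (card_union_le _ _).trans (Nat.add_le_add (hW i) ((card_cov_le F i).trans hFt))
    -- Averaging: every unabsorbed pair has at least n^k / q good absorbers, so some good `e`
    -- absorbs a proportion 1 / q of the pairs. Adding `e` to the matching multiplies their number
    -- by at most 1 - 1 / q.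
    have hex : ∃ e, good e ∧ R.card ≤ q * (ab e).card := by
      by_contra hcon
      push Not at hcon
      have h1 : R.card * n ^ k ≤ q * ∑ e with good e, (ab e).card := by
        calc R.card * n ^ k = ∑ u ∈ R, n ^ k := by simp
          _ ≤ ∑ u ∈ R, q * (univ.filter fun e => Absorbs E u.1 u.2 e ∧ good e).card := by
              refine sum_le_sum fun u hu => ?_
              rw [hR, unabsorbed, mem_filter] at hu
              exact card_absorbs hk hd hu.2.1 _ (w + t) hW'
                (le_trans (Nat.mul_le_mul_left _ (by omega)) hn)
          _ = q * ∑ u ∈ R, ∑ e with good e, if Absorbs E u.1 u.2 e then 1 else 0 := by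
              rw [mul_sum]
              refine sum_congr rfl fun u _ => ?_
              rw [← card_filter, filter_filter]
              congr 2
              ext e; simp [and_comm]
          _ = q * ∑ e with good e, (ab e).card := by
              rw [sum_comm]
              simp only [ab, card_filter]
      have hne : (univ.filter good).Nonempty := by
        by_contra hne
        rw [not_nonempty_iff_eq_empty] at hne
        have hWV : ∀ i, ∃ v, v ∉ W i ∪ cov F i := by
          intro i
          by_contra h'
          push Not at h'
          have : n ≤ w + t := by
            rw [hnd, ← card_univ, ← eq_univ_of_forall h']; exact hW' i
          have h3 : 1 * (w + (t + 1) + 2) ≤ 2 * k ^ 4 * (w + (t + 1) + 2) :=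
            Nat.mul_le_mul_right _ (Nat.one_le_iff_ne_zero.2 (by positivity))
          omega
        choose e he using hWV
        have : e ∈ univ.filter good := mem_filter.2 ⟨mem_univ _, he⟩
        rw [hne] at this
        simp at this
      have h2 : ∑ e with good e, q * (ab e).card < ∑ e with good e, R.card :=
        sum_lt_sum_of_nonempty hne fun e he => hcon e (mem_filter.1 he).2
      rw [← mul_sum, sum_const, smul_eq_mul] at h2
      have h3 : ∀ s : Finset (Fin k → V), s.card ≤ n ^ k := fun s => by
        simpa [← hnd] using card_le_univ s
      have h4 := h2.trans_le (Nat.mul_le_mul_right R.card (h3 _))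
      have := mul_comm R.card (n ^ k)
      omega
    obtain ⟨e, hge, heR⟩ := hex
    by_cases hR0 : R.card = 0
    · exact ⟨F, hF, by omega, by rw [hR0]; simp⟩
    have hab : (ab e).Nonempty := by
      rw [← card_pos]
      by_contra h0
      have : (ab e).card = 0 := by omega
      rw [this] at heR
      omega
    obtain ⟨u, hu⟩ := hab
    have heE : e ∈ E := (mem_filter.1 hu).2.1
    have hge' : ∀ i, e i ∉ W i ∧ e i ∉ cov F i := fun i => by
      simpa [not_or] using hge i
    refine ⟨insert e F, hF.insert heE (fun i => mem_compl.2 (hge' i).1) (fun i => (hge' i).2),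
      (card_insert_le _ _).trans (by omega), ?_⟩
    have hsub : unabsorbed E (insert e F) ⊆ R \ ab e := by
      intro u hu
      simp only [unabsorbed, mem_filter, mem_univ, true_and, mem_insert, forall_eq_or_imp] at hu
      simp only [ab, hR, unabsorbed, mem_sdiff, mem_filter, mem_univ, true_and, not_and]
      exact ⟨⟨hu.1, hu.2.2⟩, fun _ => hu.2.1⟩
    have h1 := card_le_card hsub
    rw [card_sdiff_of_subset (filter_subset _ _)] at h1
    have habR : (ab e).card ≤ R.card := card_le_card (filter_subset _ _)
    have h2 : q * (unabsorbed E (insert e F)).card ≤ (q - 1) * R.card := by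
      calc q * (unabsorbed E (insert e F)).card ≤ q * (R.card - (ab e).card) :=
            Nat.mul_le_mul_left _ h1
        _ = q * R.card - q * (ab e).card := Nat.mul_sub _ _ _
        _ ≤ q * R.card - R.card := Nat.sub_le_sub_left heR _
        _ = (q - 1) * R.card := by rw [Nat.sub_mul, one_mul]
    calc q ^ (t + 1) * (unabsorbed E (insert e F)).card
        = q ^ t * (q * (unabsorbed E (insert e F)).card) := by ring
      _ ≤ q ^ t * ((q - 1) * R.card) := Nat.mul_le_mul_left _ h2
      _ = (q - 1) * (q ^ t * R.card) := by ring
      _ ≤ (q - 1) * ((q - 1) ^ t * (n ^ k * n ^ k)) := Nat.mul_le_mul_left _ hFc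
      _ = _ := by ring

open Classical in
/-- There is a small matching which absorbs every pair of disjoint tuples `K` times. -/
lemma exists_absorbing [NeZero k] (hk : 3 ≤ k)
    (hd : ∀ i f, Fintype.card V ≤ k * (nbr E i f).card) (t : ℕ)
    (ht : (2 * k ^ 3 - 1) ^ t * (Fintype.card V ^ k * Fintype.card V ^ k) < (2 * k ^ 3) ^ t)
    (K : ℕ) (hn : 2 * k ^ 4 * (K * t + 2) ≤ Fintype.card V) :
    ∃ F, IsMatch E (fun _ => univ) F ∧ F.card ≤ K * t ∧
      ∀ Q Q' : Fin k → V, (∀ i, Q i ≠ Q' i) → K ≤ (F.filter (Absorbs E Q Q')).card := by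
  induction K with
  | zero => exact ⟨∅, isMatch_empty, by simp, by simp⟩
  | succ K ih =>
    have hKt : (K + 1) * t = K * t + t := by ring
    rw [hKt] at hn ⊢
    obtain ⟨F, hF, hFc, hFa⟩ := ih (le_trans (Nat.mul_le_mul_left _ (by omega)) hn)
    -- By `ht` a round leaves fewer than one unabsorbed pair, hence none. Rounds are
    -- vertex-disjoint, so each adds a new absorber to every pair.
    obtain ⟨F', hF', hFc', hFa'⟩ := exists_few_unabsorbed hk hd (cov F) (K * t)
      (fun i => (card_cov_le F i).trans hFc) t hn
    have hempty : unabsorbed E F' = ∅ := by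
      rw [← card_eq_zero]
      by_contra h0
      have h1 : (2 * k ^ 3) ^ t * 1 ≤ (2 * k ^ 3) ^ t * (unabsorbed E F').card :=
        Nat.mul_le_mul_left _ (by omega)
      omega
    have hdis : ∀ f ∈ F, ∀ g ∈ F', ∀ i, f i ≠ g i := fun f hf g hg i h =>
      mem_compl.1 (hF'.mem g hg i) (h ▸ cov_mem hf)
    refine ⟨F ∪ F', hF.union (hF'.mono fun _ => subset_univ _) hdis,
      (card_union_le _ _).trans (Nat.add_le_add hFc hFc'), fun Q Q' hQ => ?_⟩
    have hab : 1 ≤ (F'.filter (Absorbs E Q Q')).card := by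
      rw [Nat.one_le_iff_ne_zero, Ne, card_eq_zero]
      intro h0
      have : (Q, Q') ∈ unabsorbed E F' := by
        simp only [unabsorbed, mem_filter, mem_univ, true_and]
        refine ⟨hQ, fun e he hab => ?_⟩
        have : e ∈ F'.filter (Absorbs E Q Q') := mem_filter.2 ⟨he, hab⟩
        rw [h0] at this; simp at this
      rw [hempty] at this; simp at this
    rw [filter_union, card_union_of_ne fun f hf g hg =>
      hdis f (mem_filter.1 hf).1 g (mem_filter.1 hg).1]
    exact Nat.add_le_add (hFa Q Q' hQ) hab

open Classical in
-- An absorption spends one edge of `F`, which costs each pair at most one absorber, and enlarges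
-- the whole matching by one. Thus `K` bounds both the remaining absorbers and the remaining
-- deficit.
lemma exists_large_of_absorbing [NeZero k] (K : ℕ) (F M : Finset (Fin k → V))
    (hF : IsMatch E (fun _ => univ) F) (hM : IsMatch E (fun _ => univ) M)
    (hFM : ∀ f ∈ F, ∀ g ∈ M, ∀ i, f i ≠ g i)
    (hab : ∀ Q Q' : Fin k → V, (∀ i, Q i ≠ Q' i) → K ≤ (F.filter (Absorbs E Q Q')).card)
    (hc : Fintype.card V ≤ F.card + M.card + 1 + K) :
    ∃ N, IsMatch E (fun _ => univ) N ∧ Fintype.card V ≤ N.card + 1 := by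
  induction K generalizing F M with
  | zero => exact ⟨F ∪ M, hF.union hM hFM, by rw [card_union_of_ne hFM]; omega⟩
  | succ K ih =>
    by_cases hbig : Fintype.card V ≤ F.card + M.card + 1
    · exact ⟨F ∪ M, hF.union hM hFM, by rw [card_union_of_ne hFM]; omega⟩
    have hU := hF.union hM hFM
    have hleft : ∀ i, Fintype.card (Fin 2) ≤ ((cov (F ∪ M) i)ᶜ).card := by
      intro i
      rw [card_compl, card_cov hU, card_union_of_ne hFM, Fintype.card_fin]
      omega
    obtain ⟨S, hS, hSi⟩ := exists_disjoint_family (J := Fin 2) _ hleft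
    have hS01 : ∀ i, S 0 i ≠ S 1 i := fun i h => by simpa using hSi 0 1 i h
    have hpos : 0 < (F.filter (Absorbs E (S 0) (S 1))).card :=
      lt_of_lt_of_le (Nat.succ_pos K) (hab _ _ hS01)
    obtain ⟨e, he⟩ := card_pos.1 hpos
    obtain ⟨heF, heE, -, f, hf, g, hg, hfg⟩ := mem_filter.1 he
    have hne : ∀ a, ∀ h ∈ F ∪ M, ∀ i, S a i ≠ h i := fun a h hh i heq =>
      mem_compl.1 (hS a i) (heq ▸ cov_mem hh)
    have hnew : ∀ h ∈ F.erase e ∪ M, ∀ p : Fin k → V,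
        (∀ i, p i = e i ∨ p i = S 0 i ∨ p i = S 1 i) → ∀ i, h i ≠ p i := by
      intro h hh p hp i heq
      have hhU : h ∈ F ∪ M := union_subset_union_left (erase_subset _ _) hh
      rcases hp i with h1 | h1 | h1
      · have : h = e := hU.inj h hhU e (mem_union_left _ heF) i (heq.trans h1)
        subst this
        rcases mem_union.1 hh with h2 | h2
        · exact (notMem_erase _ _) h2
        · exact hFM h heF h h2 i rfl
      · exact hne 0 h hhU i (h1 ▸ heq.symm)
      · exact hne 1 h hhU i (h1 ▸ heq.symm)
    have hpair : IsMatch E (fun _ => univ) {f, g} :=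
      isMatch_pair hf hg (by simp) (by simp) fun i => (hfg i).1
    have hdisj : ∀ h ∈ F.erase e ∪ M, ∀ p ∈ ({f, g} : Finset (Fin k → V)), ∀ i, h i ≠ p i := by
      intro h hh p hp
      rcases mem_insert.1 hp with rfl | hp
      · exact hnew h hh _ fun i => (hfg i).2.1
      · rw [mem_singleton] at hp; subst hp
        exact hnew h hh _ fun i => (hfg i).2.2
    have hdM : ∀ h ∈ M, ∀ p ∈ ({f, g} : Finset (Fin k → V)), ∀ i, h i ≠ p i :=
      fun h hh => hdisj h (mem_union_right _ hh)
    refine ih (F.erase e) (M ∪ {f, g}) (hF.subset (erase_subset _ _))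
      (hM.union hpair hdM) ?_ ?_ ?_
    · intro h hh p hp i
      rcases mem_union.1 hp with hp | hp
      · exact hFM h (mem_of_mem_erase hh) p hp i
      · exact hdisj h (mem_union_left _ hh) p hp i
    · intro Q Q' hQ
      have h1 := hab Q Q' hQ
      have h2 : (F.filter (Absorbs E Q Q')).erase e ⊆ (F.erase e).filter (Absorbs E Q Q') := by
        intro x hx
        simp only [mem_erase, mem_filter] at hx ⊢
        tauto
      have h3 := card_le_card h2
      have h4 := pred_card_le_card_erase (s := F.filter (Absorbs E Q Q')) (a := e)
      omega
    · rw [card_union_of_ne hdM, card_pair fun h' => (hfg 0).1 (congrFun h' 0),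
        card_erase_of_mem heF]
      have := card_pos.2 ⟨e, heF⟩
      omega

/-! ### Stability: a deficient maximum matching forces the extremal structure. -/

/-- If a maximum matching inside almost full classes `Z i` leaves many vertices uncovered, then
the graph is close to the extremal one, in which all edges meet `⋃ A i`. -/
lemma exists_extremal_partition [NeZero k] {d φ : ℕ}
    (hnd : Fintype.card V ≤ k * d) (hdn : k * d ≤ Fintype.card V + k)
    (hd : ∀ i f, d ≤ (nbr E i f).card) (hZ : ∀ i, ((Z i)ᶜ).card ≤ φ)
    (hM : IsMaxMatch E Z M) (hleft : ∀ i, k * k ≤ (Z i \ cov M i).card) :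
    ∃ A G : Fin k → Finset V, (∀ i, Disjoint (A i) (G i)) ∧
      (∀ i, Fintype.card V ≤ k * ((A i).card + ((k ^ 3 + k + 1) * φ + k))) ∧
      (∀ i, k * (A i).card ≤ Fintype.card V + k * ((k ^ 3 + k + 1) * φ + k)) ∧
      (∀ i, Fintype.card V ≤ (A i).card + (G i).card + ((k ^ 3 + k + 1) * φ + k)) ∧
      ∀ i T, (∀ l, l ≠ i → T l ∈ G l) →
        (nbr E i T \ A i).card ≤ (k ^ 3 + k + 1) * φ + k := by
  classical
  set n := Fintype.card V with hn
  have hk1 : 1 ≤ k := Nat.one_le_iff_ne_zero.2 (NeZero.ne k)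
  -- In `S (a, i)` the second index is the coordinate to be completed and the first labels k
  -- independent rows. For a given class `j`, row `j` is kept as a witness and the other rows pay
  -- for swaps.
  obtain ⟨S, hS, hSi⟩ := exists_disjoint_family (J := Fin k × Fin k)
    (fun i => Z i \ cov M i) (by simpa using hleft)
  have hSM : ∀ x l, ∀ g ∈ M, S x l ≠ g l := fun x l g hg h =>
    (mem_sdiff.1 (hS x l)).2 (h ▸ cov_mem hg)
  have hSZ : ∀ x l, S x l ∈ Z l := fun x l => (mem_sdiff.1 (hS x l)).1
  let X : Fin k → Fin k → Finset (Fin k → V) := fun a i => hit E M i (S (a, i))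
  have hXd : ∀ a b i j, i ≠ j → Disjoint (X a i) (X b j) := fun a b i j hij =>
    hM.disjoint_hit hij (fun l _ => hS _ l) (fun l _ => hS _ l) fun l _ _ h =>
      hij (congrArg Prod.snd (hSi _ _ l h))
  have hXM : ∀ a i, X a i ⊆ M := fun a i => filter_subset _ _
  have hXc : ∀ a i, d ≤ (X a i).card + φ := by
    intro a i
    have h1 := hM.card_nbr_le (i := i) (Q := S (a, i)) (fun l _ => hS _ l)
    have h2 : nbr E i (S (a, i)) ⊆ (nbr E i (S (a, i)) ∩ Z i) ∪ (Z i)ᶜ := by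
      intro v hv
      by_cases hvZ : v ∈ Z i <;> simp [hvZ, mem_nbr.1 hv]
    have h3 := (card_le_card h2).trans (card_union_le _ _)
    have h4 := hd i (S (a, i))
    have h5 := hZ i
    change (nbr E i (S (a, i)) ∩ Z i).card ≤ (X a i).card at h1
    omega
  have hMn : M.card ≤ n := by
    rw [← card_cov hM.1 0]; exact card_le_univ _
  -- The k - 1 disjoint sets `X a j` with `j ≠ i` have at least d - φ edges each, and M has at most
  -- n ≤ kd edges.
  have hY : ∀ a i, ∀ Y ⊆ M, (∀ j, j ≠ i → Disjoint Y (X a j)) → Y.card ≤ d + (k - 1) * φ := by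
    intro a i Y hYM hYd
    have h1 : Disjoint Y ((univ.erase i).biUnion (X a)) :=
      (disjoint_biUnion_right _ _ _).2 fun j hj => hYd j (mem_erase.1 hj).1
    have h2 : Y ∪ (univ.erase i).biUnion (X a) ⊆ M :=
      union_subset hYM (biUnion_subset.2 fun j _ => hXM a j)
    have h3 := card_le_card h2
    rw [card_union_of_disjoint h1, card_biUnion fun x _ y _ hxy => hXd a a x y hxy] at h3
    have h4 : ∑ j ∈ univ.erase i, d ≤ ∑ j ∈ univ.erase i, ((X a j).card + φ) :=
      sum_le_sum fun j _ => hXc a j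
    rw [sum_add_distrib, sum_const, sum_const, card_erase_of_mem (mem_univ i), card_univ,
      Fintype.card_fin, smul_eq_mul, smul_eq_mul] at h4
    have h5 : k * d = (k - 1) * d + d := by
      rw [← Nat.succ_mul]; congr 1; omega
    omega
  -- Edges of type `i`, on which all rows agree. By `hY` the rows differ in few edges, so this loses
  -- little.
  let Mi : Fin k → Finset (Fin k → V) := fun i => M.filter fun e => ∀ a, e ∈ X a i
  have hMiM : ∀ i, Mi i ⊆ M := fun i => filter_subset _ _
  have hMiX : ∀ a i, Mi i ⊆ X a i := fun a i e he => (mem_filter.1 he).2 a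
  have hMid : ∀ i j, i ≠ j → Disjoint (Mi i) (Mi j) := fun i j hij =>
    (hXd 0 0 i j hij).mono (hMiX 0 i) (hMiX 0 j)
  have hMic : ∀ i, d ≤ (Mi i).card + (k ^ 2 + 1) * φ := by
    intro i
    let U := univ.biUnion fun a => X a i
    have hU : U.card ≤ d + (k - 1) * φ := hY 0 i U (biUnion_subset.2 fun a _ => hXM a i)
      fun j hj => (disjoint_biUnion_left _ _ _).2 fun a _ => hXd a 0 i j hj.symm
    have h1 : ∀ a, (U \ X a i).card ≤ k * φ := by
      intro a
      have h2 : X a i ⊆ U := subset_biUnion_of_mem (fun a => X a i) (mem_univ a)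
      rw [card_sdiff_of_subset h2]
      have h3 := hXc a i
      have h4 : k * φ = (k - 1) * φ + φ := by
        rw [← Nat.succ_mul]; congr 1; omega
      omega
    have h2 : X 0 i ⊆ Mi i ∪ univ.biUnion fun a => U \ X a i := by
      intro e he
      rw [mem_union]
      by_cases h : ∀ a, e ∈ X a i
      · exact Or.inl (mem_filter.2 ⟨hXM 0 i he, h⟩)
      · push Not at h
        obtain ⟨a, ha⟩ := h
        exact Or.inr (mem_biUnion.2 ⟨a, mem_univ _, mem_sdiff.2
          ⟨mem_biUnion.2 ⟨0, mem_univ _, he⟩, ha⟩⟩)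
    have h3 := (card_le_card h2).trans (card_union_le _ _)
    have h4 : (univ.biUnion fun a => U \ X a i).card ≤ ∑ _a : Fin k, k * φ :=
      card_biUnion_le.trans (sum_le_sum fun a _ => h1 a)
    rw [sum_const, card_univ, Fintype.card_fin, smul_eq_mul] at h4
    have h5 := hXc 0 i
    have h6 : (k ^ 2 + 1) * φ = k * (k * φ) + φ := by ring
    omega
  have hMile : ∀ i, (Mi i).card ≤ d + (k - 1) * φ := fun i =>
    hY 0 i (Mi i) (hMiM i) fun j hj => (hXd 0 0 i j hj.symm).mono_left (hMiX 0 i)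
  -- An edge of type `i` gives its `i`-th vertex to `A` and all its other vertices to `G`.
  let A : Fin k → Finset V := fun i => cov (Mi i) i
  let G : Fin k → Finset V := fun j => cov ((univ.erase j).biUnion Mi) j
  have hAc : ∀ i, (A i).card = (Mi i).card := fun i => card_cov (hM.1.subset (hMiM i)) i
  have hGM : ∀ j, (univ.erase j).biUnion Mi ⊆ M := fun j => biUnion_subset.2 fun i _ => hMiM i
  have hk13 : (k - 1) * φ ≤ k * φ := Nat.mul_le_mul_right _ (by omega)
  refine ⟨A, G, ?_, ?_, ?_, ?_, ?_⟩
  · intro i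
    rw [disjoint_left]
    intro v hv hv'
    obtain ⟨f, hf, rfl⟩ := mem_cov.1 hv
    obtain ⟨g, hg, hgf⟩ := mem_cov.1 hv'
    have hgf' := hM.1.inj g (hGM i hg) f (hMiM i hf) i hgf
    subst hgf'
    obtain ⟨j, hj, hgj⟩ := mem_biUnion.1 hg
    exact disjoint_left.1 (hMid i j (mem_erase.1 hj).1.symm) hf hgj
  · intro i
    refine hnd.trans (Nat.mul_le_mul_left _ ?_)
    have h1 := hMic i
    rw [hAc]
    have h2 : (k ^ 2 + 1) * φ ≤ (k ^ 3 + k + 1) * φ := by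
      refine Nat.mul_le_mul_right _ ?_
      have : k ^ 2 ≤ k ^ 3 := Nat.pow_le_pow_right hk1 (by norm_num)
      omega
    omega
  · intro i
    have h1 := Nat.mul_le_mul_left k (hMile i)
    rw [hAc]
    have h2 : k * (d + (k - 1) * φ) = k * d + k * ((k - 1) * φ) := by ring
    have h3 : k * ((k - 1) * φ + 1) ≤ k * ((k ^ 3 + k + 1) * φ + k) := by
      refine Nat.mul_le_mul_left _ ?_
      have : k * φ ≤ (k ^ 3 + k + 1) * φ := Nat.mul_le_mul_right _ (by omega)
      omega
    have h4 : k * ((k - 1) * φ + 1) = k * ((k - 1) * φ) + k := by ring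
    omega
  · intro i
    have h1 : (G i).card = ∑ j ∈ univ.erase i, (Mi j).card := by
      rw [card_cov (hM.1.subset (hGM i)), card_biUnion fun x _ y _ hxy => hMid x y hxy]
    rw [hAc, h1, add_sum_erase _ (fun j => (Mi j).card) (mem_univ i)]
    have h2 : ∑ _j : Fin k, d ≤ ∑ j : Fin k, ((Mi j).card + (k ^ 2 + 1) * φ) :=
      sum_le_sum fun j _ => hMic j
    rw [sum_add_distrib, sum_const, sum_const, card_univ, Fintype.card_fin, smul_eq_mul,
      smul_eq_mul] at h2
    have h3 : k * ((k ^ 2 + 1) * φ) + φ = (k ^ 3 + k + 1) * φ := by ring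
    omega
  · intro j T hT
    have hex : ∀ l, ∃ e, ∃ τ, l ≠ j → τ ≠ l ∧ e ∈ Mi τ ∧ e l = T l := by
      intro l
      by_cases hl : l = j
      · exact ⟨T, l, fun h => absurd hl h⟩
      · obtain ⟨e, he, hel⟩ := mem_cov.1 (hT l hl)
        obtain ⟨τ, hτ, heτ⟩ := mem_biUnion.1 he
        exact ⟨e, τ, fun _ => ⟨(mem_erase.1 hτ).1, heτ, hel⟩⟩
    choose e τ heτ using hex
    let D : Finset (Fin k → V) := (univ.erase j).image e
    have hDM : D ⊆ M := by
      intro g hg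
      obtain ⟨l, hl, rfl⟩ := mem_image.1 hg
      exact hMiM _ (heτ l (mem_erase.1 hl).1).2.1
    have hrep : ∀ g, ∃ l, g ∈ D → l ≠ j ∧ e l = g := by
      intro g
      by_cases hg : g ∈ D
      · obtain ⟨l, hl, hlg⟩ := mem_image.1 hg
        exact ⟨l, fun _ => ⟨(mem_erase.1 hl).1, hlg⟩⟩
      · exact ⟨j, fun h => absurd h hg⟩
    choose a ha using hrep
    -- Each edge `g` through a vertex of `T` is swapped for a leftover tuple completed by the vertex
    -- of `g` in the coordinate of its type. This type differs from the coordinate of that vertex of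
    -- `T`, so `T` becomes uncovered. Distinct edges use distinct rows, never row `j`.
    let h : (Fin k → V) → Fin k → V :=
      fun g => update (S (a g, τ (a g))) (τ (a g)) (g (τ (a g)))
    have hgMi : ∀ g ∈ D, g ∈ Mi (τ (a g)) := by
      intro g hg
      obtain ⟨h1, h2⟩ := ha g hg
      have := (heτ (a g) h1).2.1
      rwa [h2] at this
    have hcase : ∀ g l, (l = τ (a g) ∧ h g l = g l) ∨
        (h g l = S (a g, τ (a g)) l) := by
      intro g l
      by_cases hl : l = τ (a g)
      · left; refine ⟨hl, ?_⟩; subst hl; simp [h]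
      · right; simp [h, hl]
    have hinj : ∀ g ∈ D, ∀ g' ∈ D, ∀ l, h g l = h g' l → g = g' := by
      intro g hg g' hg' l hl
      rcases hcase g l with ⟨-, h1⟩ | h1 <;> rcases hcase g' l with ⟨-, h2⟩ | h2
      · exact hM.1.inj g (hDM hg) g' (hDM hg') l (by rw [← h1, ← h2, hl])
      · exact absurd (by rw [← h1, ← h2, hl]) (hSM (a g', τ (a g')) l g (hDM hg))
      · exact absurd (by rw [← h1, ← h2, hl]) (hSM (a g, τ (a g)) l g' (hDM hg'))
      · have h3 := congrArg Prod.fst (hSi _ _ l (h1.symm.trans (hl.trans h2)))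
        rw [← (ha g hg).2, ← (ha g' hg').2]
        exact congrArg e h3
    have hne : ∀ f ∈ M \ D, ∀ g ∈ D, ∀ l, f l ≠ h g l := by
      intro f hf g hg l hl
      rw [mem_sdiff] at hf
      rcases hcase g l with ⟨-, h1⟩ | h1
      · have := hM.1.inj f hf.1 g (hDM hg) l (hl.trans h1)
        exact hf.2 (this ▸ hg)
      · exact hSM _ l f hf.1 (h1.symm.trans hl.symm)
    have hNmatch : IsMatch E Z (D.image h) := by
      refine ⟨?_, ?_, ?_⟩
      · intro f hf
        obtain ⟨g, hg, rfl⟩ := mem_image.1 hf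
        exact (mem_hit.1 (hMiX (a g) _ (hgMi g hg))).2
      · intro f hf l
        obtain ⟨g, hg, rfl⟩ := mem_image.1 hf
        rcases hcase g l with ⟨-, h1⟩ | h1 <;> rw [h1]
        · exact hM.1.mem g (hDM hg) l
        · exact hSZ _ l
      · intro f hf f' hf' l hl
        obtain ⟨g, hg, rfl⟩ := mem_image.1 hf
        obtain ⟨g', hg', rfl⟩ := mem_image.1 hf'
        rw [hinj g hg g' hg' l hl]
    have hne' : ∀ f ∈ M \ D, ∀ g ∈ D.image h, ∀ l, f l ≠ g l := by
      intro f hf g hg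
      obtain ⟨g', hg', rfl⟩ := mem_image.1 hg
      exact hne f hf g' hg'
    have hNcard : (D.image h).card = D.card :=
      card_image_of_injOn fun g hg g' hg' hgg => hinj g hg g' hg' 0 (congrFun hgg 0)
    have hM' : IsMaxMatch E Z ((M \ D) ∪ D.image h) := by
      refine ⟨(hM.1.subset sdiff_subset).union hNmatch hne', fun N hN => ?_⟩
      rw [card_union_of_ne hne', hNcard, card_sdiff_add_card_eq_card hDM]
      exact hM.2 N hN
    have hTl : ∀ l, l ≠ j → T l ∈ Z l \ cov ((M \ D) ∪ D.image h) l := by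
      intro l hl
      obtain ⟨h1, h2, h3⟩ := heτ l hl
      have hlD : e l ∈ D := mem_image_of_mem _ (mem_erase.2 ⟨hl, mem_univ _⟩)
      rw [mem_sdiff, ← h3]
      refine ⟨hM.1.mem _ (hMiM _ h2) l, fun hc => ?_⟩
      obtain ⟨f, hf, hfl⟩ := mem_cov.1 hc
      rcases mem_union.1 hf with hf | hf
      · have h4 := mem_sdiff.1 hf
        have := hM.1.inj f h4.1 _ (hDM hlD) l hfl
        exact h4.2 (this ▸ hlD)
      · obtain ⟨g, hg, rfl⟩ := mem_image.1 hf
        rcases hcase g l with ⟨h4, h5⟩ | h5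
        · have h6 := hM.1.inj g (hDM hg) _ (hDM hlD) l (h5.symm.trans hfl)
          have h7 : τ (a g) = τ l := by
            by_contra hcon
            exact disjoint_left.1 (hMid _ _ hcon) (hgMi g hg) (h6 ▸ h2)
          exact h1 (h7.symm.trans h4.symm)
        · exact hSM _ l _ (hDM hlD) (h5.symm.trans hfl)
    have hSl : ∀ i l, S (j, i) l ∈ Z l \ cov ((M \ D) ∪ D.image h) l := by
      intro i l
      refine mem_sdiff.2 ⟨hSZ _ l, fun hc => ?_⟩
      obtain ⟨f, hf, hfl⟩ := mem_cov.1 hc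
      rcases mem_union.1 hf with hf | hf
      · exact hSM _ l f (mem_sdiff.1 hf).1 hfl.symm
      · obtain ⟨g, hg, rfl⟩ := mem_image.1 hf
        rcases hcase g l with ⟨-, h5⟩ | h5
        · exact hSM _ l g (hDM hg) (hfl.symm.trans h5)
        · exact (ha g hg).1 (congrArg Prod.fst (hSi _ _ l (h5.symm.trans hfl)))
    have hTS : ∀ i l, l ≠ j → T l ≠ S (j, i) l := by
      intro i l hl heq
      obtain ⟨h1, h2, h3⟩ := heτ l hl
      exact hSM (j, i) l _ (hMiM _ h2) (by rw [h3, heq])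
    let Y := M.filter fun f => ∀ i, i ≠ j → f ∉ X j i
    have hYc : Y.card ≤ d + (k - 1) * φ := hY j j Y (filter_subset _ _) fun i hi =>
      disjoint_left.2 fun f hf => (mem_filter.1 hf).2 i hi
    have hMiY : Mi j ⊆ Y := fun f hf => mem_filter.2 ⟨hMiM j hf, fun i hi hf' =>
      disjoint_left.1 (hXd j j i j hi) hf' (hMiX j j hf)⟩
    -- The swapped matching is still maximum, and both `T` and row `j` are leftover for it. So a
    -- surviving edge whose `j`-th vertex completes `T` lies in no `X j i` with `i ≠ j`, that is, it
    -- lies in `Y`, which is nearly `Mi j`.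
    have hsub : nbr E j T \ A j ⊆ (Z j)ᶜ ∪ (cov (Y \ Mi j) j ∪ cov (D.image h) j) := by
      intro v hv
      obtain ⟨hv, hvA⟩ := mem_sdiff.1 hv
      rw [mem_nbr] at hv
      rw [mem_union, mem_union, mem_compl]
      by_cases hvZ : v ∈ Z j
      · right
        by_cases hvc : v ∈ cov ((M \ D) ∪ D.image h) j
        · obtain ⟨f, hf, rfl⟩ := mem_cov.1 hvc
          rcases mem_union.1 hf with hf' | hf'
          · left
            refine cov_mem (mem_sdiff.2 ⟨mem_filter.2 ⟨(mem_sdiff.1 hf').1, fun i hi hfX => ?_⟩,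
              fun hfM => hvA (cov_mem hfM)⟩)
            exact hM'.not_two_of_leftover hi.symm hTl (fun l _ => hSl i l)
              (fun l hl _ => hTS i l hl) hf hv (mem_hit.1 hfX).2
          · exact Or.inr (cov_mem hf')
        · exact absurd hv (hM'.notMem_of_leftover hTl (mem_sdiff.2 ⟨hvZ, hvc⟩))
      · exact Or.inl hvZ
    have h1 := (card_le_card hsub).trans ((card_union_le _ _).trans
      (Nat.add_le_add_left (card_union_le _ _) _))
    have h2 := card_cov_le (Y \ Mi j) j
    rw [card_sdiff_of_subset hMiY] at h2
    have h3 := card_cov_le (D.image h) j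
    have h4 : D.card ≤ k - 1 := by
      refine card_image_le.trans ?_
      rw [card_erase_of_mem (mem_univ j)]; simp
    have h5 := hZ j
    have h6 := hMic j
    have h7 : (k ^ 2 + 1) * φ + k * φ + φ ≤ (k ^ 3 + k + 1) * φ + φ := by
      have : (k ^ 2 + 1) * φ + k * φ + φ = (k ^ 2 + k + 1) * φ + φ := by ring
      rw [this]
      refine Nat.add_le_add_right (Nat.mul_le_mul_right _ ?_) _
      have : k ^ 2 ≤ k ^ 3 := Nat.pow_le_pow_right hk1 (by norm_num)
      omega
    have h8 : k * φ = (k - 1) * φ + φ := by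
      rw [← Nat.succ_mul]; congr 1; omega
    omega

/-! ### Perfect matchings in dense blocks. -/

/-- The falling factorial is at least (m / 2)^(k-1). This is the union bound over the k tuples
created by a cyclic shift. -/
lemma sum_lt_descFactorial [NeZero k] {m : ℕ} (hm : 2 * k ≤ m) (c : Fin k → ℕ)
    (hc : ∀ i, k * 2 ^ k * c i < m ^ (k - 1)) :
    ∑ i, c i < (m - 1).descFactorial (k - 1) := by
  have hk1 : 1 ≤ k := Nat.one_le_iff_ne_zero.2 (NeZero.ne k)
  have h1 : ∑ i : Fin k, k * 2 ^ k * c i < ∑ _i : Fin k, m ^ (k - 1) :=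
    sum_lt_sum_of_nonempty ⟨0, mem_univ _⟩ fun i _ => hc i
  rw [← mul_sum, sum_const, card_univ, Fintype.card_fin, smul_eq_mul, mul_assoc] at h1
  have h2 : 2 ^ k * ∑ i, c i < m ^ (k - 1) := Nat.lt_of_mul_lt_mul_left h1
  have h3 : m ^ (k - 1) ≤ 2 ^ (k - 1) * (m - 1).descFactorial (k - 1) := by
    calc m ^ (k - 1) ≤ (2 * (m - 1 + 1 - (k - 1))) ^ (k - 1) :=
          Nat.pow_le_pow_left (by omega) _
      _ = 2 ^ (k - 1) * (m - 1 + 1 - (k - 1)) ^ (k - 1) := mul_pow _ _ _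
      _ ≤ _ := Nat.mul_le_mul_left _ (Nat.pow_sub_le_descFactorial _ _)
  have h4 : 2 ^ (k - 1) ≤ 2 ^ k := Nat.pow_le_pow_right (by norm_num) (by omega)
  exact Nat.lt_of_mul_lt_mul_left (h2.trans_le (h3.trans (Nat.mul_le_mul_right _ h4)))

/-- A `k`-partite graph with classes of size `m` in which every vertex misses only a small
proportion of the tuples has a perfect matching. -/
lemma exists_perfect_matching [NeZero k] {m : ℕ} (hm : 2 * k ≤ m) (hZ : ∀ i, (Z i).card = m)
    (hmiss : ∀ i, ∀ z ∈ Z i, k * 2 ^ k *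
      (univ.filter fun f : Fin k → V => f ∉ E ∧ f i = z ∧ ∀ l, l ≠ i → f l ∈ Z l).card <
        m ^ (k - 1)) :
    ∃ M, IsMatch E Z M ∧ M.card = m := by
  classical
  obtain ⟨S, hS, hSi⟩ := exists_disjoint_family (J := Fin m) Z (by simp [hZ])
  have hex : (univ.powerset.filter fun P : Finset (Fin k → V) =>
      IsMatch univ Z P ∧ P.card = m).Nonempty := by
    refine ⟨univ.image S, mem_filter.2 ⟨by simp, ⟨by simp, ?_, ?_⟩, ?_⟩⟩
    · intro f hf i
      obtain ⟨x, -, rfl⟩ := mem_image.1 hf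
      exact hS x i
    · intro f hf g hg i hfg
      obtain ⟨x, -, rfl⟩ := mem_image.1 hf
      obtain ⟨y, -, rfl⟩ := mem_image.1 hg
      rw [hSi x y i hfg]
    · rw [card_image_of_injective _ fun x y hxy => hSi x y 0 (congrFun hxy 0)]
      simp
  -- Among all partitions of the classes into disjoint tuples, take one with the most edges.
  obtain ⟨P, hP, hmax⟩ := exists_max_image _ (fun P => (P ∩ E).card) hex
  obtain ⟨-, hPm, hPc⟩ := mem_filter.1 hP
  by_cases hPE : P ⊆ E
  · exact ⟨P, ⟨hPE, hPm.mem, hPm.inj⟩, hPc⟩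
  exfalso
  obtain ⟨x, hxP, hxE⟩ := not_subset.1 hPE
  let Φ := {r : Fin k // r ≠ 0} ↪ {p // p ∈ P.erase x}
  let ext : Φ → Fin k → Fin k → V := fun e r => if h : r = 0 then x else (e ⟨r, h⟩ : Fin k → V)
  have hext0 : ∀ e, ext e 0 = x := fun e => by simp [ext]
  have hextr : ∀ (e : Φ) r (h : r ≠ 0), ext e r = (e ⟨r, h⟩ : Fin k → V) := fun e r h => by
    simp [ext, h]
  have hextP : ∀ e r, ext e r ∈ P := by
    intro e r
    by_cases h : r = 0
    · rw [h, hext0]; exact hxP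
    · rw [hextr e r h]; exact mem_of_mem_erase (e ⟨r, h⟩).2
  have hextinj : ∀ e r s, ext e r = ext e s → r = s := by
    intro e r s hrs
    by_cases hr : r = 0 <;> by_cases hs : s = 0
    · rw [hr, hs]
    · rw [hr, hext0, hextr e s hs] at hrs
      exact absurd hrs.symm (mem_erase.1 (e ⟨s, hs⟩).2).1
    · rw [hs, hext0, hextr e r hr] at hrs
      exact absurd hrs (mem_erase.1 (e ⟨r, hr⟩).2).1
    · rw [hextr e r hr, hextr e s hs] at hrs
      simpa using e.injective (Subtype.ext hrs)
  -- Cyclic shifts of the non-edge `x` and k - 1 other tuples of `P`: the `i`-th new tuple contains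
  -- `x i`, and together they use the same vertices as the old ones. Given `i`, the new tuple
  -- determines all the tuples chosen, so few choices make it a non-edge.
  let F : Φ → Fin k → Fin k → V := fun e i l => ext e (l - i) l
  have hbad : ∀ i, (univ.filter fun e : Φ => F e i ∉ E).card ≤
      (univ.filter fun f : Fin k → V => f ∉ E ∧ f i = x i ∧ ∀ l, l ≠ i → f l ∈ Z l).card := by
    intro i
    refine card_le_card_of_injOn (fun e => F e i) ?_ ?_
    · intro e he
      simp only [coe_filter, mem_univ, true_and, Set.mem_ofPred_eq] at he ⊢
      exact ⟨he, by simp [F, hext0], fun l _ => hPm.mem _ (hextP e _) l⟩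
    · intro e _ e' _ hee
      ext r : 1
      obtain ⟨r, hr⟩ := r
      have h1 : ext e r (r + i) = ext e' r (r + i) := by
        simpa [F] using congrFun hee (r + i)
      have h2 := hPm.inj _ (hextP e r) _ (hextP e' r) _ h1
      rw [hextr e r hr, hextr e' r hr] at h2
      exact Subtype.ext h2
  have hcardΦ : Fintype.card Φ = (m - 1).descFactorial (k - 1) := by
    rw [Fintype.card_embedding_eq]
    congr 1
    · rw [Fintype.card_coe, card_erase_of_mem hxP, hPc]
    · rw [Fintype.card_subtype_compl, Fintype.card_fin, Fintype.card_subtype_eq]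
  obtain ⟨e, he⟩ : ∃ e : Φ, ∀ i, F e i ∈ E := by
    by_contra hcon
    push Not at hcon
    have h1 : (univ : Finset Φ) ⊆ univ.biUnion fun i => univ.filter fun e : Φ => F e i ∉ E := by
      intro e _
      obtain ⟨i, hi⟩ := hcon e
      exact mem_biUnion.2 ⟨i, mem_univ _, mem_filter.2 ⟨mem_univ _, hi⟩⟩
    have h2 := (card_le_card h1).trans (card_biUnion_le.trans (sum_le_sum fun i _ => hbad i))
    rw [card_univ, hcardΦ] at h2
    exact absurd (sum_lt_descFactorial hm _ fun i => hmiss i (x i) (hPm.mem x hxP i)) h2.not_gt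
  have hdis : ∀ f ∈ P \ univ.image (ext e), ∀ g ∈ univ.image (F e), ∀ l, f l ≠ g l := by
    intro f hf g hg l hfg
    obtain ⟨i, -, rfl⟩ := mem_image.1 hg
    rw [mem_sdiff] at hf
    have := hPm.inj f hf.1 _ (hextP e (l - i)) l hfg
    exact hf.2 (mem_image.2 ⟨_, mem_univ _, this.symm⟩)
  have hFinj : ∀ i j l, F e i l = F e j l → i = j := by
    intro i j l hij
    have := hextinj e _ _ (hPm.inj _ (hextP e _) _ (hextP e _) l hij)
    exact sub_right_injective this
  have hFm : IsMatch univ Z (univ.image (F e)) := by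
    refine ⟨by simp, ?_, ?_⟩
    · intro f hf l
      obtain ⟨i, -, rfl⟩ := mem_image.1 hf
      exact hPm.mem _ (hextP e _) l
    · intro f hf g hg l hfg
      obtain ⟨i, -, rfl⟩ := mem_image.1 hf
      obtain ⟨j, -, rfl⟩ := mem_image.1 hg
      rw [hFinj i j l hfg]
  have hDP : univ.image (ext e) ⊆ P := by
    intro f hf
    obtain ⟨r, -, rfl⟩ := mem_image.1 hf
    exact hextP e r
  have hDc : (univ.image (ext e)).card = k := by
    rw [card_image_of_injective _ fun r s h => hextinj e r s h]; simp
  have hNc : (univ.image (F e)).card = k := by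
    rw [card_image_of_injective _ fun i j h => hFinj i j 0 (congrFun h 0)]; simp
  have hnew := hmax ((P \ univ.image (ext e)) ∪ univ.image (F e)) (mem_filter.2 ⟨by simp,
    (hPm.subset sdiff_subset).union hFm hdis, by
      have := card_sdiff_add_card_eq_card hDP
      rw [card_union_of_ne hdis]; omega⟩)
  have h1 : ((P ∩ E) \ univ.image (ext e)) ∪ univ.image (F e) ⊆
      ((P \ univ.image (ext e)) ∪ univ.image (F e)) ∩ E := by
    intro f hf
    rcases mem_union.1 hf with hf | hf
    · simp only [mem_sdiff, mem_inter] at hf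
      exact mem_inter.2 ⟨mem_union_left _ (mem_sdiff.2 ⟨hf.1.1, hf.2⟩), hf.1.2⟩
    · obtain ⟨i, -, rfl⟩ := mem_image.1 hf
      exact mem_inter.2 ⟨mem_union_right _ hf, he i⟩
  have h2 := card_le_card h1
  rw [card_union_of_ne fun f hf g hg => hdis f
    (sdiff_subset_sdiff inter_subset_left (Subset.refl _) hf) g hg, hNc] at h2
  -- As `x` is not an edge, at most k - 1 edges are lost, while k are gained.
  have h3 : P ∩ E ⊆ ((P ∩ E) \ univ.image (ext e)) ∪ (univ.image (ext e)).erase x := by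
    intro f hf
    rw [mem_union, mem_sdiff, mem_erase]
    by_cases hfD : f ∈ univ.image (ext e)
    · exact Or.inr ⟨fun h => hxE (h ▸ (mem_inter.1 hf).2), hfD⟩
    · exact Or.inl ⟨hf, hfD⟩
  have h4 := (card_le_card h3).trans (card_union_le _ _)
  rw [card_erase_of_mem (mem_image.2 ⟨0, mem_univ _, hext0 e⟩), hDc] at h4
  have hk1 : 1 ≤ k := Nat.one_le_iff_ne_zero.2 (NeZero.ne k)
  omega

/-! ### The extremal structure, with atypical vertices removed. -/

/-- The classes split, up to `b` vertices each, into `A i` of size about `|V| / k` and `G i`,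
such that the tuples of `G` see almost all of `A`, and the vertices of `A` see almost all tuples
of `G`. -/
structure IsExtremal (E : Finset (Fin k → V)) (A G : Fin k → Finset V) (b C : ℕ) : Prop where
  disj : ∀ i, Disjoint (A i) (G i)
  le_A : ∀ i, Fintype.card V ≤ k * ((A i).card + b)
  A_le : ∀ i, k * (A i).card ≤ Fintype.card V + k * b
  le_AG : ∀ i, Fintype.card V ≤ (A i).card + (G i).card + b
  tuple : ∀ i T, (∀ l, l ≠ i → T l ∈ G l) → (A i \ nbr E i T).card ≤ b
  vertex : ∀ i, ∀ a ∈ A i, C *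
    (univ.filter fun f : Fin k → V => f ∉ E ∧ f i = a ∧ ∀ l, l ≠ i → f l ∈ G l).card ≤
      Fintype.card V ^ (k - 1)

/-- A neighbourhood of size at least d that has few vertices outside `A i` must contain almost all
of `A i`, whose size is at most d + b. Double counting the missing pairs shows that few vertices of
`A i` miss many tuples; these are deleted from `A i` and become exceptional. -/
lemma exists_isExtremal [NeZero k] {d b : ℕ} (C : ℕ) (hV : 0 < Fintype.card V)
    (hnd : Fintype.card V ≤ k * d) (hd : ∀ i f, d ≤ (nbr E i f).card) {A G : Fin k → Finset V}
    (disj : ∀ i, Disjoint (A i) (G i))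
    (le_A : ∀ i, Fintype.card V ≤ k * ((A i).card + b))
    (A_le : ∀ i, k * (A i).card ≤ Fintype.card V + k * b)
    (le_AG : ∀ i, Fintype.card V ≤ (A i).card + (G i).card + b)
    (tuple : ∀ i T, (∀ l, l ≠ i → T l ∈ G l) → (nbr E i T \ A i).card ≤ b) :
    ∃ A', IsExtremal E A' G ((2 * C + 2) * b) C := by
  classical
  set n := Fintype.card V with hn
  have hk1 : 1 ≤ k := Nat.one_le_iff_ne_zero.2 (NeZero.ne k)
  have hmiss : ∀ i T, (∀ l, l ≠ i → T l ∈ G l) → (A i \ nbr E i T).card ≤ 2 * b := by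
    intro i T hT
    have h1 : k * (A i).card ≤ k * (d + b) := by
      rw [Nat.mul_add]; exact (A_le i).trans (Nat.add_le_add_right hnd _)
    have h2 := Nat.le_of_mul_le_mul_left h1 (by omega)
    have h3 := card_sdiff_add_card_inter (A i) (nbr E i T)
    have h4 := card_sdiff_add_card_inter (nbr E i T) (A i)
    rw [inter_comm] at h4
    have h5 := hd i T
    have h6 := tuple i T hT
    omega
  let miss : Fin k → V → Finset (Fin k → V) := fun i a =>
    univ.filter fun f : Fin k → V => f ∉ E ∧ f i = a ∧ ∀ l, l ≠ i → f l ∈ G l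
  let bad : Fin k → Finset V := fun i => (A i).filter fun a => n ^ (k - 1) < C * (miss i a).card
  have htotal : ∀ i, ∑ a ∈ A i, (miss i a).card ≤ 2 * b * n ^ (k - 1) := by
    intro i
    let L : Finset (Fin k → V) := univ.filter fun f => ∀ l, l ≠ i → f l ∈ G l
    have h1 : (((A i).sigma (miss i)) ×ˢ (univ : Finset V)).card ≤
        (L.sigma fun f => A i \ nbr E i f).card := by
      refine card_le_card_of_injOn (fun x => ⟨update x.1.2 i x.2, x.1.1⟩) ?_ ?_
      · rintro ⟨⟨a, f⟩, v⟩ hx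
        simp only [coe_product, coe_sigma, Set.mem_prod, Set.mem_sigma_iff, mem_coe, miss,
          mem_filter, mem_univ, true_and, and_true] at hx
        obtain ⟨ha, hf, hfa, hfG⟩ := hx
        simp only [coe_sigma, Set.mem_sigma_iff, mem_coe, L, mem_filter, mem_univ, true_and,
          mem_sdiff, mem_nbr, update_idem]
        refine ⟨fun l hl => by simpa [hl] using hfG l hl, ha, ?_⟩
        rw [← hfa, update_eq_self]; exact hf
      · rintro ⟨⟨a, f⟩, v⟩ hx ⟨⟨a', f'⟩, v'⟩ hx' hxx
        simp only [coe_product, coe_sigma, Set.mem_prod, Set.mem_sigma_iff, mem_coe, miss,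
          mem_filter, mem_univ, true_and, and_true] at hx hx'
        simp only [Sigma.mk.injEq, heq_eq_eq] at hxx
        obtain ⟨h1, rfl⟩ := hxx
        have hv : v = v' := by simpa using congrFun h1 i
        have hf : f = f' := by
          ext l
          by_cases hl : l = i
          · rw [hl, hx.2.2.1, hx'.2.2.1]
          · simpa [hl] using congrFun h1 l
        rw [hv, hf]
    rw [card_product, card_sigma, card_sigma, card_univ] at h1
    have h2 : ∑ f ∈ L, (A i \ nbr E i f).card ≤ ∑ f ∈ L, 2 * b :=
      sum_le_sum fun f hf => hmiss i f (mem_filter.1 hf).2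
    rw [sum_const, smul_eq_mul] at h2
    have h3 : L.card ≤ n ^ k := by simpa [← hn] using card_le_univ L
    have hpow : n ^ k = n ^ (k - 1) * n := by rw [← pow_succ]; congr 1; omega
    refine Nat.le_of_mul_le_mul_right ?_ hV
    calc _ ≤ L.card * (2 * b) := h1.trans h2
      _ ≤ n ^ k * (2 * b) := Nat.mul_le_mul_right _ h3
      _ = _ := by rw [hpow, hn]; ring
  have hbadc : ∀ i, (bad i).card ≤ C * (2 * b) := by
    intro i
    refine Nat.le_of_mul_le_mul_right ?_ (pow_pos hV (k - 1))
    calc (bad i).card * n ^ (k - 1) = ∑ a ∈ bad i, n ^ (k - 1) := by simp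
      _ ≤ ∑ a ∈ bad i, C * (miss i a).card :=
          sum_le_sum fun a ha => (mem_filter.1 ha).2.le
      _ ≤ ∑ a ∈ A i, C * (miss i a).card := sum_le_sum_of_subset (filter_subset _ _)
      _ = C * ∑ a ∈ A i, (miss i a).card := by rw [mul_sum]
      _ ≤ C * (2 * b * n ^ (k - 1)) := Nat.mul_le_mul_left _ (htotal i)
      _ = _ := by ring
  have hA' : ∀ i, (A i).card ≤ (A i \ bad i).card + C * (2 * b) := by
    intro i
    have := le_card_sdiff (bad i) (A i)
    have := hbadc i
    omega
  have hb' : (2 * C + 2) * b = C * (2 * b) + 2 * b := by ring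
  refine ⟨fun i => A i \ bad i, fun i => (disj i).mono_left sdiff_subset, fun i => ?_,
    fun i => ?_, fun i => ?_, fun i T hT => ?_, fun i a ha => ?_⟩
  · refine (le_A i).trans (Nat.mul_le_mul_left _ ?_)
    have := hA' i
    omega
  · refine (Nat.mul_le_mul_left k (card_le_card (sdiff_subset (t := bad i)))).trans
      ((A_le i).trans (Nat.add_le_add_left (Nat.mul_le_mul_left _ ?_) _))
    omega
  · have := hA' i
    have := le_AG i
    omega
  · have := card_le_card (sdiff_subset_sdiff (sdiff_subset (s := A i) (t := bad i))
      (Subset.refl (nbr E i T)))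
    have := hmiss i T hT
    omega
  · obtain ⟨h1, h2⟩ := mem_sdiff.1 ha
    by_contra hcon
    exact h2 (mem_filter.2 ⟨h1, not_le.1 hcon⟩)

/-! ### Extremal case: the correcting matching. -/

variable {A G : Fin k → Finset V}

/-- If a maximum matching outside `A` were smaller than `s`, it would leave k disjoint tuples. The
`i`-th is completed in coordinate `i` by at least d - |A i| of its edges, and by the exchange
argument these k sets of edges are disjoint. -/
lemma exists_isMatch_compl [NeZero k] {d s : ℕ} (hd : ∀ i f, d ≤ (nbr E i f).card)
    (A : Fin k → Finset V) (hs : s ≤ ∑ i, (d - (A i).card))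
    (hA : ∀ i, s + k ≤ ((A i)ᶜ).card) :
    ∃ M, IsMatch E (fun i => (A i)ᶜ) M ∧ M.card = s := by
  obtain ⟨M, hM⟩ := exists_isMaxMatch E fun i => (A i)ᶜ
  by_cases hMs : s ≤ M.card
  · obtain ⟨N, hN, hNc⟩ := exists_subset_card_eq hMs
    exact ⟨N, hM.1.subset hN, hNc⟩
  exfalso
  obtain ⟨S, hS, hSi⟩ := exists_disjoint_family (J := Fin k) (fun i => (A i)ᶜ \ cov M i) (by
    intro i
    have h1 := le_card_sdiff (cov M i) (A i)ᶜ
    have h2 := card_cov_le M i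
    have h3 := hA i
    rw [Fintype.card_fin]
    omega)
  have hdis : ∀ i j, i ≠ j → Disjoint (hit E M i (S i)) (hit E M j (S j)) := fun i j hij =>
    hM.disjoint_hit hij (fun l _ => hS i l) (fun l _ => hS j l) fun l _ _ h => hij (hSi i j l h)
  have hc : ∀ i, d - (A i).card ≤ (hit E M i (S i)).card := by
    intro i
    have h1 := hM.card_nbr_le (i := i) (Q := S i) (fun l _ => hS i l)
    have h2 := hd i (S i)
    have h3 : (nbr E i (S i)).card ≤ (nbr E i (S i) ∩ (A i)ᶜ).card + (A i).card := by
      rw [← sdiff_eq_inter_compl]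
      have := le_card_sdiff (A i) (nbr E i (S i))
      omega
    omega
  have h1 : (univ.biUnion fun i => hit E M i (S i)).card ≤ M.card :=
    card_le_card (biUnion_subset.2 fun i _ => filter_subset _ _)
  rw [card_biUnion fun i _ j _ hij => hdis i j hij] at h1
  have h2 := sum_le_sum fun i (_ : i ∈ univ) => hc i
  omega

/-- The number of vertices of the tuple `f` in `A`. -/
def hits (A : Fin k → Finset V) (f : Fin k → V) : ℕ := (univ.filter fun i => f i ∈ A i).card

/-- The number of edges of `M` minus the number of vertices of `A` that they cover. -/
def excess (A : Fin k → Finset V) (M : Finset (Fin k → V)) : ℤ := ∑ f ∈ M, (1 - (hits A f : ℤ))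

lemma excess_insert {f : Fin k → V} (hf : f ∉ M) :
    excess A (insert f M) = 1 - (hits A f : ℤ) + excess A M := sum_insert hf

/-- Subtracting the n - |M| edges still needed, the surplus of uncovered vertices of `A` is ∑ |A i|
- n + `excess A M`. This is the quantity to be balanced. -/
lemma sum_card_sdiff_cov (hM : IsMatch E Z M) (A : Fin k → Finset V) :
    (∑ i, ((A i \ cov M i).card : ℤ)) = ∑ i, ((A i).card : ℤ) + excess A M - M.card := by
  have h1 : ∀ i, ((A i \ cov M i).card : ℤ) =
      (A i).card - ∑ f ∈ M, if f i ∈ A i then (1 : ℤ) else 0 := by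
    intro i
    have h2 := card_sdiff_add_card_inter (A i) (cov M i)
    have h3 : (A i ∩ cov M i).card = (M.filter fun f => f i ∈ A i).card := by
      rw [← card_cov (hM.subset (filter_subset (fun f => f i ∈ A i) M)) i]
      congr 1
      ext v
      simp only [mem_inter, mem_cov, mem_filter]
      constructor
      · rintro ⟨hv, f, hf, rfl⟩; exact ⟨f, ⟨hf, hv⟩, rfl⟩
      · rintro ⟨f, ⟨hf, hv⟩, rfl⟩; exact ⟨hv, f, hf, rfl⟩
    rw [card_filter] at h3
    have h4 : ((∑ f ∈ M, if f i ∈ A i then 1 else 0 : ℕ) : ℤ) =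
        ∑ f ∈ M, if f i ∈ A i then (1 : ℤ) else 0 := by push_cast; rfl
    rw [← h4, ← h3]
    omega
  have h5 : ∀ f : Fin k → V, (∑ i, if f i ∈ A i then (1 : ℤ) else 0) = hits A f := by
    intro f; simp [hits]
  rw [sum_congr rfl fun i _ => h1 i, sum_sub_distrib, sum_comm, sum_congr rfl fun f _ => h5 f,
    excess, sum_sub_distrib]
  simp only [sum_const, nsmul_eq_mul, mul_one]
  ring

/-- Each exceptional vertex is extended by vertices of `G` and one completing vertex, the only one
that may lie in `A`. So every new edge changes the excess by 0 or 1. -/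
lemma exists_cover_exceptional [NeZero k] (hk : 3 ≤ k) {d b : ℕ}
    (hd : ∀ i f, d ≤ (nbr E i f).card) (hAG : ∀ i, Disjoint (A i) (G i))
    (hY : ∀ i, ((A i ∪ G i)ᶜ).card ≤ b) (u : ℕ) (M : Finset (Fin k → V))
    (hM : IsMatch E (fun _ => univ) M)
    (hu : ∑ i, ((A i ∪ G i)ᶜ \ cov M i).card ≤ u)
    (h1 : M.card + u + b ≤ d) (h2 : ∀ i, M.card + u ≤ (G i).card) :
    ∃ M', IsMatch E (fun _ => univ) M' ∧ (∀ i, (A i ∪ G i)ᶜ ⊆ cov M' i) ∧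
      M'.card ≤ M.card + u ∧ excess A M ≤ excess A M' ∧ excess A M' ≤ excess A M + u := by
  induction u generalizing M with
  | zero =>
    refine ⟨M, hM, fun i => ?_, by simp, le_rfl, by simp⟩
    rw [← sdiff_eq_empty_iff_subset, ← card_eq_zero]
    exact (sum_eq_zero_iff.1 (Nat.le_zero.1 hu)) i (mem_univ i)
  | succ u ih =>
    by_cases hall : ∀ i, (A i ∪ G i)ᶜ ⊆ cov M i
    · exact ⟨M, hM, hall, by simp, le_rfl, by simp; omega⟩
    push Not at hall
    obtain ⟨j, hj⟩ := hall
    obtain ⟨y, hyY, hyM⟩ := not_subset.1 hj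
    obtain ⟨i, hij⟩ : ∃ i : Fin k, i ≠ j := by
      have : Nontrivial (Fin k) := Fin.nontrivial_iff_two_le.2 (by omega)
      exact exists_ne j
    have hG : ∀ l, ∃ v, v ∈ G l \ cov M l := by
      intro l
      apply card_pos.1
      have := le_card_sdiff (cov M l) (G l)
      have := card_cov_le M l
      have := h2 l
      omega
    choose g hg using hG
    obtain ⟨w, hw⟩ : ∃ w, w ∈ nbr E i (update g j y) \ (cov M i ∪ (A i ∪ G i)ᶜ) := by
      apply card_pos.1
      have := le_card_sdiff (cov M i ∪ (A i ∪ G i)ᶜ) (nbr E i (update g j y))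
      have := card_union_le (cov M i) (A i ∪ G i)ᶜ
      have := card_cov_le M i
      have := hY i
      have := hd i (update g j y)
      omega
    simp only [mem_sdiff, mem_nbr, mem_union, mem_compl, not_or] at hw
    set f := update (update g j y) i w with hf
    have hfi : f i = w := by simp [hf]
    have hfj : f j = y := by simp [hf, hij.symm]
    have hfl : ∀ l, l ≠ i → l ≠ j → f l = g l := fun l hl hl' => by simp [hf, hl, hl']
    have hfc : ∀ l, f l ∉ cov M l := by
      intro l
      by_cases hl : l = i
      · rw [hl, hfi]; exact hw.2.1
      by_cases hl' : l = j
      · rw [hl', hfj]; exact hyM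
      rw [hfl l hl hl']; exact (mem_sdiff.1 (hg l)).2
    have hfM := notMem_of_cov hfc
    have hyA : y ∉ A j := fun h => mem_compl.1 hyY (mem_union_left _ h)
    have hhits : hits A f ≤ 1 := by
      refine (card_le_card (t := {i}) ?_).trans (by simp)
      intro l hl
      rw [mem_filter] at hl
      rw [mem_singleton]
      by_contra hli
      by_cases hl' : l = j
      · rw [hl', hfj] at hl; exact hyA hl.2
      · rw [hfl l hli hl'] at hl
        exact disjoint_left.1 (hAG l) hl.2 (mem_sdiff.1 (hg l)).1
    have hsub : ∀ l, (A l ∪ G l)ᶜ \ cov (insert f M) l ⊆ (A l ∪ G l)ᶜ \ cov M l :=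
      fun l => sdiff_subset_sdiff (Subset.refl _) (image_subset_image (subset_insert _ _))
    have hlt : ∑ l, ((A l ∪ G l)ᶜ \ cov (insert f M) l).card <
        ∑ l, ((A l ∪ G l)ᶜ \ cov M l).card := by
      refine sum_lt_sum (fun l _ => card_le_card (hsub l)) ⟨j, mem_univ _, card_lt_card ?_⟩
      refine (ssubset_iff_of_subset (hsub j)).2 ⟨y, mem_sdiff.2 ⟨hyY, hyM⟩, fun h => ?_⟩
      exact (mem_sdiff.1 h).2 (mem_cov.2 ⟨f, mem_insert_self _ _, hfj⟩)
    have hcard := card_insert_of_notMem hfM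
    obtain ⟨M', hM', hYM', hM'c, he1, he2⟩ := ih (insert f M)
      (hM.insert hw.1 (fun _ => mem_univ _) hfc) (by omega) (by omega) (fun l => by
        have := h2 l; omega)
    rw [excess_insert hfM] at he1 he2
    refine ⟨M', hM', hYM', by omega, by omega, by push_cast; omega⟩

/-- An edge with at least k - 1 vertices in `A` lowers the excess by k - 2 or k - 1. For k ≥ 3 this
is progress, and a surplus above k - 1 cannot become negative in one step. -/
lemma exists_reduce_excess [NeZero k] (hk : 3 ≤ k) {d : ℕ}
    (hd : ∀ i f, d ≤ (nbr E i f).card) (R : ℤ) (Y : Fin k → Finset V) (u : ℕ)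
    (M : Finset (Fin k → V)) (hM : IsMatch E (fun _ => univ) M) (hY : ∀ i, Y i ⊆ cov M i)
    (h0 : 0 ≤ R + excess A M) (hu : R + excess A M ≤ u + (k - 1 : ℕ))
    (h1 : M.card + u ≤ d) (h2 : ∀ i, M.card + u ≤ (A i).card) :
    ∃ M', IsMatch E (fun _ => univ) M' ∧ (∀ i, Y i ⊆ cov M' i) ∧
      M'.card ≤ M.card + u ∧ 0 ≤ R + excess A M' ∧ R + excess A M' ≤ (k - 1 : ℕ) := by
  induction u generalizing M with
  | zero => exact ⟨M, hM, hY, by simp, h0, by simpa using hu⟩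
  | succ u ih =>
    by_cases hsmall : R + excess A M ≤ (k - 1 : ℕ)
    · exact ⟨M, hM, hY, by simp, h0, hsmall⟩
    have hA : ∀ l, ∃ v, v ∈ A l \ cov M l := by
      intro l
      apply card_pos.1
      have := le_card_sdiff (cov M l) (A l)
      have := card_cov_le M l
      have := h2 l
      omega
    choose g hg using hA
    obtain ⟨w, hw⟩ : ∃ w, w ∈ nbr E 0 g \ cov M 0 := by
      apply card_pos.1
      have := le_card_sdiff (cov M 0) (nbr E 0 g)
      have := card_cov_le M 0
      have := hd 0 g
      omega
    rw [mem_sdiff, mem_nbr] at hw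
    set f := update g 0 w with hf
    have hfc : ∀ l, f l ∉ cov M l := by
      intro l
      by_cases hl : l = 0
      · subst hl; simpa [hf] using hw.2
      · simpa [hf, hl] using (mem_sdiff.1 (hg l)).2
    have hfM := notMem_of_cov hfc
    have hh1 : k - 1 ≤ hits A f := by
      have : univ.erase (0 : Fin k) ⊆ univ.filter fun i => f i ∈ A i := by
        intro l hl
        have hl0 := (mem_erase.1 hl).1
        simpa [hf, hl0] using (mem_sdiff.1 (hg l)).1
      have h3 := card_le_card this
      rw [card_erase_of_mem (mem_univ _), card_univ, Fintype.card_fin] at h3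
      exact h3
    have hh2 : hits A f ≤ k := (card_le_univ _).trans (by simp)
    have hcard := card_insert_of_notMem hfM
    have hex := excess_insert (A := A) hfM
    obtain ⟨M', hM', hYM', hM'c, he1, he2⟩ := ih (insert f M)
      (hM.insert hw.1 (fun _ => mem_univ _) hfc)
      (fun l => (hY l).trans (image_subset_image (subset_insert _ _)))
      (by omega) (by push_cast at hu; omega) (by omega) (fun l => by have := h2 l; omega)
    exact ⟨M', hM', hYM', by omega, he1, he2⟩

/-! ### Extremal case: splitting the rest into dense blocks. -/

lemma exists_disjoint_subsets {ι : Type*} [DecidableEq ι] (I : Finset ι) (c : ι → ℕ)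
    (T : Finset V) (hT : ∑ j ∈ I, c j ≤ T.card) :
    ∃ Z : ι → Finset V, (∀ j ∈ I, Z j ⊆ T ∧ (Z j).card = c j) ∧
      ∀ j ∈ I, ∀ j' ∈ I, j ≠ j' → Disjoint (Z j) (Z j') := by
  induction I using Finset.induction_on generalizing T with
  | empty => exact ⟨fun _ => ∅, by simp, by simp⟩
  | insert a I ha ih =>
    rw [sum_insert ha] at hT
    obtain ⟨T₁, hT₁, hc₁⟩ := exists_subset_card_eq (show c a ≤ T.card by omega)
    obtain ⟨Z, hZ, hd⟩ := ih (T \ T₁) (by rw [card_sdiff_of_subset hT₁]; omega)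
    have hne : ∀ j ∈ I, j ≠ a := fun j hj h => ha (h ▸ hj)
    have hda : ∀ j ∈ I, Disjoint T₁ (Z j) := fun j hj =>
      disjoint_sdiff.mono_right (hZ j hj).1
    refine ⟨update Z a T₁, ?_, ?_⟩
    · intro j hj
      rcases mem_insert.1 hj with rfl | hj
      · simpa using ⟨hT₁, hc₁⟩
      · rw [update_of_ne (hne j hj)]
        exact ⟨(hZ j hj).1.trans sdiff_subset, (hZ j hj).2⟩
    · intro j hj j' hj' hjj
      rcases mem_insert.1 hj with h | h <;> rcases mem_insert.1 hj' with h' | h'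
      · exact absurd (h.trans h'.symm) hjj
      · rw [h, update_self, update_of_ne (hne j' h')]; exact hda j' h'
      · rw [h', update_self, update_of_ne (hne j h)]; exact (hda j h).symm
      · rw [update_of_ne (hne j h), update_of_ne (hne j' h')]; exact hd j h j' h' hjj

lemma IsMatch.biUnion [NeZero k] {ι : Type*} [DecidableEq ι] [Fintype ι]
    {Z : ι → Fin k → Finset V} {N : ι → Finset (Fin k → V)} (hN : ∀ j, IsMatch E (Z j) (N j))
    (hd : ∀ j j', j ≠ j' → ∀ i, Disjoint (Z j i) (Z j' i)) :
    IsMatch E (fun i => univ.biUnion fun j => Z j i) (univ.biUnion N) ∧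
      (univ.biUnion N).card = ∑ j, (N j).card := by
  have key : ∀ j j', ∀ f ∈ N j, ∀ g ∈ N j', ∀ i, f i = g i → j = j' := by
    intro j j' f hf g hg i hfg
    by_contra hjj
    exact disjoint_left.1 (hd j j' hjj i) ((hN j).mem f hf i) (hfg ▸ (hN j').mem g hg i)
  refine ⟨⟨biUnion_subset.2 fun j _ => (hN j).sub, ?_, ?_⟩, card_biUnion ?_⟩
  · intro f hf i
    obtain ⟨j, -, hj⟩ := mem_biUnion.1 hf
    exact mem_biUnion.2 ⟨j, mem_univ _, (hN j).mem f hj i⟩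
  · intro f hf g hg i hfg
    obtain ⟨j, -, hj⟩ := mem_biUnion.1 hf
    obtain ⟨j', -, hj'⟩ := mem_biUnion.1 hg
    have := key j j' f hj g hj' i hfg
    subst this
    exact (hN j).inj f hj g hj' i hfg
  · intro j _ j' _ hjj
    exact disjoint_left.2 fun f hf hf' => hjj (key j j' f hf f hf' 0 rfl)

/-- Sum the `tuple` clause over all tuples through `z`. Hence only the vertices of `A` require the
separate clause `vertex`. -/
lemma IsExtremal.card_missing_le [NeZero k] {b C : ℕ} (h : IsExtremal E A G b C)
    (hV : 0 < Fintype.card V) (hb : C * b ≤ Fintype.card V) {i j : Fin k} (hij : i ≠ j) (z : V) :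
    C * (univ.filter fun f : Fin k → V => f ∉ E ∧ f i = z ∧ f j ∈ A j ∧
      ∀ l, l ≠ j → f l ∈ G l).card ≤ Fintype.card V ^ (k - 1) := by
  set n := Fintype.card V with hn
  set B := univ.filter fun f : Fin k → V => f ∉ E ∧ f i = z ∧ f j ∈ A j ∧
      ∀ l, l ≠ j → f l ∈ G l with hB
  let L : Finset (Fin k → V) := univ.filter fun f => f i = z ∧ ∀ l, l ≠ j → f l ∈ G l
  have h1 : (B ×ˢ (univ : Finset V)).card ≤ (L.sigma fun f => A j \ nbr E j f).card := by
    refine card_le_card_of_injOn (fun x => ⟨update x.1 j x.2, x.1 j⟩) ?_ ?_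
    · rintro ⟨f, v⟩ hx
      simp only [coe_product, Set.mem_prod, mem_coe, hB, mem_filter, mem_univ, true_and,
        and_true] at hx
      obtain ⟨hf, hfi, hfj, hfG⟩ := hx
      simp only [coe_sigma, Set.mem_sigma_iff, mem_coe, L, mem_filter, mem_univ, true_and,
        mem_sdiff, mem_nbr, update_idem, update_eq_self]
      exact ⟨⟨by rw [update_of_ne hij, hfi], fun l hl => by simpa [hl] using hfG l hl⟩, hfj, hf⟩
    · rintro ⟨f, v⟩ hx ⟨f', v'⟩ hx' hxx
      simp only [Sigma.mk.injEq, heq_eq_eq] at hxx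
      obtain ⟨h1, h2⟩ := hxx
      have hv : v = v' := by simpa using congrFun h1 j
      have hf : f = f' := by
        ext l
        by_cases hl : l = j
        · rw [hl, h2]
        · simpa [hl] using congrFun h1 l
      rw [hv, hf]
  rw [card_product, card_sigma, card_univ] at h1
  have h2 : ∑ f ∈ L, (A j \ nbr E j f).card ≤ ∑ f ∈ L, b :=
    sum_le_sum fun f hf => h.tuple j f (mem_filter.1 hf).2.2
  rw [sum_const, smul_eq_mul] at h2
  have h3 : L.card ≤ n ^ (k - 1) := by
    have h4 := card_filter_coord_mem (k := k) i {z}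
    rw [card_singleton, one_mul] at h4
    rw [hn, ← h4]
    exact card_le_card fun f hf => by
      simp only [L, mem_filter, mem_univ, true_and, mem_singleton] at hf ⊢
      exact hf.1
  refine Nat.le_of_mul_le_mul_right ?_ hV
  calc C * B.card * n = C * (B.card * n) := by ring
    _ ≤ C * (n ^ (k - 1) * b) := Nat.mul_le_mul_left _ (h1.trans (h2.trans
        (Nat.mul_le_mul_right _ h3)))
    _ = n ^ (k - 1) * (C * b) := by ring
    _ ≤ n ^ (k - 1) * n := Nat.mul_le_mul_left _ hb

/-- Passes from the whole classes to blocks of size m ≥ n / (2k); this is the source of the factor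
(2k)^k. -/
lemma missing_lt_of_mul_le (hk : 3 ≤ k) {n m c : ℕ} (hm : 0 < m) (hn : n ≤ 2 * k * m)
    (hc : k * 2 ^ k * (2 * k) ^ k * c ≤ n ^ (k - 1)) : k * 2 ^ k * c < m ^ (k - 1) := by
  rcases Nat.eq_zero_or_pos c with rfl | hc0
  · simpa using pow_pos hm _
  have h1 : n ^ (k - 1) ≤ (2 * k) ^ (k - 1) * m ^ (k - 1) := by
    rw [← mul_pow]; exact Nat.pow_le_pow_left hn _
  have h2 : (2 * k) ^ k = (2 * k) ^ (k - 1) * (2 * k) := by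
    rw [← pow_succ]; congr 1; omega
  have hp : 0 < (2 * k) ^ (k - 1) := by positivity
  have h3 : (2 * k) ^ (k - 1) * (2 * k * (k * 2 ^ k * c)) ≤ (2 * k) ^ (k - 1) * m ^ (k - 1) := by
    refine le_trans (le_of_eq ?_) (hc.trans h1)
    rw [h2]; ring
  have h4 := Nat.le_of_mul_le_mul_left h3 hp
  have h5 : 0 < k * 2 ^ k * c := by positivity
  have h6 : 2 * (k * 2 ^ k * c) ≤ 2 * k * (k * 2 ^ k * c) :=
    Nat.mul_le_mul_right _ (by omega)
  omega

lemma IsExtremal.exists_extension [NeZero k] (hk : 3 ≤ k) {b : ℕ}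
    (h : IsExtremal E A G b (k * 2 ^ k * (2 * k) ^ k)) (hb : 1 ≤ b)
    (hC : k * 2 ^ k * (2 * k) ^ k * b ≤ Fintype.card V)
    (hM : IsMatch E (fun _ => univ) M) (hY : ∀ i, (A i ∪ G i)ᶜ ⊆ cov M i)
    (h0 : 0 ≤ ∑ i, ((A i).card : ℤ) - Fintype.card V + excess A M)
    (h1 : ∑ i, ((A i).card : ℤ) - Fintype.card V + excess A M ≤ (k - 1 : ℕ))
    (hA : ∀ i, Fintype.card V + 2 * k * (M.card + 1) ≤ 2 * k * (A i).card)
    (hA2 : ∀ i, M.card + 1 + 2 * k ≤ (A i).card) (hG : ∀ i, M.card + 1 ≤ (G i).card) :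
    ∃ N, IsMatch E (fun _ => univ) N ∧ Fintype.card V ≤ N.card + 1 := by
  set n := Fintype.card V with hn
  have hn0 : 0 < n := by
    refine lt_of_lt_of_le ?_ hC
    have : 0 < k := by omega
    positivity
  -- One tuple `x` is given up, with `q` vertices in `A`, so that the remaining vertices of `A`
  -- number exactly n - |M| - 1, the number of edges still to be found. The surplus lies in [0, k -
  -- 1], so 1 ≤ q ≤ k.
  obtain ⟨q, hq⟩ : ∃ q : ℕ, (q : ℤ) = ∑ i, ((A i).card : ℤ) - n + excess A M + 1 :=
    ⟨(∑ i, ((A i).card : ℤ) - n + excess A M + 1).toNat, Int.toNat_of_nonneg (by omega)⟩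
  have hqk : q ≤ k := by omega
  have hx : ∀ i : Fin k, ∃ v, (i.val < q → v ∈ A i \ cov M i) ∧
      (¬ i.val < q → v ∈ G i \ cov M i) := by
    intro i
    have hc := card_cov_le M i
    by_cases hi : i.val < q
    · obtain ⟨v, hv⟩ : (A i \ cov M i).Nonempty := by
        apply card_pos.1
        have := le_card_sdiff (cov M i) (A i)
        have := hA2 i
        omega
      exact ⟨v, fun _ => hv, fun h => absurd hi h⟩
    · obtain ⟨v, hv⟩ : (G i \ cov M i).Nonempty := by
        apply card_pos.1
        have := le_card_sdiff (cov M i) (G i)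
        have := hG i
        omega
      exact ⟨v, fun h => absurd h hi, fun _ => hv⟩
  choose x hxA hxG using hx
  let A' : Fin k → Finset V := fun i => (A i \ cov M i).erase (x i)
  let G' : Fin k → Finset V := fun i => (G i \ cov M i).erase (x i)
  have hA'A : ∀ i, A' i ⊆ A i := fun i => (erase_subset _ _).trans sdiff_subset
  have hG'G : ∀ i, G' i ⊆ G i := fun i => (erase_subset _ _).trans sdiff_subset
  have hA'c : ∀ i, (A' i).card + (if i.val < q then 1 else 0) = (A i \ cov M i).card := by
    intro i
    split_ifs with hi
    · have := card_pos.2 ⟨_, hxA i hi⟩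
      rw [card_erase_of_mem (hxA i hi)]; omega
    · change ((A i \ cov M i).erase (x i)).card + 0 = _
      rw [erase_eq_of_notMem, add_zero]
      exact fun h' => disjoint_left.1 (h.disj i) (mem_sdiff.1 h').1 (mem_sdiff.1 (hxG i hi)).1
  have hG'c : ∀ i, (G' i).card + (if i.val < q then 0 else 1) = (G i \ cov M i).card := by
    intro i
    split_ifs with hi
    · change ((G i \ cov M i).erase (x i)).card + 0 = _
      rw [erase_eq_of_notMem, add_zero]
      exact fun h' => disjoint_left.1 (h.disj i) (mem_sdiff.1 (hxA i hi)).1 (mem_sdiff.1 h').1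
    · have := card_pos.2 ⟨_, hxG i hi⟩
      rw [card_erase_of_mem (hxG i hi)]; omega
  have htot : ∀ i, (A i \ cov M i).card + (G i \ cov M i).card + M.card = n := by
    intro i
    rw [← card_cov hM i, ← card_union_of_disjoint ((h.disj i).mono sdiff_subset sdiff_subset),
      ← union_sdiff_distrib, card_sdiff_add_card, hn, ← card_univ]
    congr 1
    rw [eq_univ_iff_forall]
    intro v
    by_cases hv : v ∈ A i ∪ G i
    · exact mem_union_left _ hv
    · exact mem_union_right _ (hY i (mem_compl.2 hv))
  have hsumq : ∑ i : Fin k, (if i.val < q then 1 else 0) = q := by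
    rw [← card_filter, Fin.card_filter_val_lt]; omega
  have hsumA' : ∑ i, (A' i).card + M.card + 1 = n := by
    have h2 := sum_card_sdiff_cov hM A
    have h3 : ∑ i, (A' i).card + q = ∑ i, (A i \ cov M i).card := by
      rw [← hsumq, ← sum_add_distrib]; exact sum_congr rfl fun i _ => hA'c i
    have h4 : (∑ i, ((A i \ cov M i).card : ℤ)) = ((∑ i, (A i \ cov M i).card : ℕ) : ℤ) := by
      push_cast; rfl
    omega
  -- The balance leaves in `G' i` exactly ∑ |A' j| vertices, summed over j ≠ i. Block `j` consists
  -- of `A' j` and, in every other class, equally many vertices of `G'`.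
  have hW : ∀ i, ∃ W : Fin k → Finset V,
      (∀ j ∈ univ.erase i, W j ⊆ G' i ∧ (W j).card = (A' j).card) ∧
      ∀ j ∈ univ.erase i, ∀ j' ∈ univ.erase i, j ≠ j' → Disjoint (W j) (W j') := by
    intro i
    apply exists_disjoint_subsets
    have h2 := add_sum_erase univ (fun j => (A' j).card) (mem_univ i)
    have h3 := hA'c i
    have h4 := hG'c i
    have h5 := htot i
    by_cases hi : i.val < q
    · simp only [hi, if_true] at h3 h4; omega
    · simp only [hi, if_false] at h3 h4; omega
  choose W hW hWd using hW
  let Z : Fin k → Fin k → Finset V := fun j i => if j = i then A' i else W i j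
  have hZself : ∀ j, Z j j = A' j := fun j => by simp [Z]
  have hZne : ∀ j i, j ≠ i → Z j i = W i j := fun j i hij => by simp [Z, hij]
  have hZG : ∀ j i, j ≠ i → Z j i ⊆ G' i := fun j i hij => by
    rw [hZne j i hij]; exact (hW i j (mem_erase.2 ⟨hij, mem_univ _⟩)).1
  have hZc : ∀ j i, (Z j i).card = (A' j).card := by
    intro j i
    by_cases hij : j = i
    · subst hij; rw [hZself]
    · rw [hZne j i hij]; exact (hW i j (mem_erase.2 ⟨hij, mem_univ _⟩)).2
  have hAG' : ∀ i, Disjoint (A' i) (G' i) := fun i => (h.disj i).mono (hA'A i) (hG'G i)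
  have hZd : ∀ j j', j ≠ j' → ∀ i, Disjoint (Z j i) (Z j' i) := by
    intro j j' hjj i
    by_cases hj : j = i
    · subst hj
      rw [hZself]
      exact (hAG' j).mono_right (hZG j' j hjj.symm)
    · by_cases hj' : j' = i
      · subst hj'
        rw [hZself]
        exact ((hAG' j').mono_right (hZG j j' hj)).symm
      · rw [hZne j i hj, hZne j' i hj']
        exact hWd i j (mem_erase.2 ⟨hj, mem_univ _⟩) j' (mem_erase.2 ⟨hj', mem_univ _⟩) hjj
  have hZM : ∀ j i, Disjoint (cov M i) (Z j i) := by
    intro j i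
    rw [disjoint_left]
    intro v hv hvZ
    by_cases hij : j = i
    · subst hij
      rw [hZself] at hvZ
      exact (mem_sdiff.1 (mem_of_mem_erase hvZ)).2 hv
    · exact (mem_sdiff.1 (mem_of_mem_erase (hZG j i hij hvZ))).2 hv
  have hA'ge : ∀ j, (A j).card ≤ (A' j).card + (M.card + 1) := by
    intro j
    have h2 := le_card_sdiff (cov M j) (A j)
    have h3 := card_cov_le M j
    have h4 := hA'c j
    split_ifs at h4 <;> omega
  have hmatch : ∀ j, ∃ N, IsMatch E (Z j) N ∧ N.card = (A' j).card := by
    intro j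
    have h2 := hA2 j
    have h3 := hA'ge j
    refine exists_perfect_matching (by omega) (hZc j) fun i z hz => ?_
    refine missing_lt_of_mul_le hk (n := n) (by omega) ?_ ?_
    · have h4 := hA j
      have h5 := Nat.mul_le_mul_left (2 * k) h3
      rw [Nat.mul_add] at h5
      omega
    · by_cases hij : j = i
      · subst hij
        rw [hZself] at hz
        refine le_trans (Nat.mul_le_mul_left _ (card_le_card fun f hf => ?_))
          (h.vertex j z (hA'A j hz))
        simp only [mem_filter, mem_univ, true_and] at hf ⊢
        exact ⟨hf.1, hf.2.1, fun l hl => hG'G l (hZG j l hl.symm (hf.2.2 l hl))⟩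
      · refine le_trans (Nat.mul_le_mul_left _ (card_le_card fun f hf => ?_))
          (h.card_missing_le hn0 hC (Ne.symm hij) z)
        simp only [mem_filter, mem_univ, true_and] at hf ⊢
        obtain ⟨hfE, hfz, hfl⟩ := hf
        have hfZ : ∀ l, f l ∈ Z j l := by
          intro l
          by_cases hl : l = i
          · subst hl; rwa [hfz]
          · exact hfl l hl
        exact ⟨hfE, hfz, hA'A j (hZself j ▸ hfZ j),
          fun l hl => hG'G l (hZG j l hl.symm (hfZ l))⟩
  choose N hN hNc using hmatch
  obtain ⟨hU, hUc⟩ := IsMatch.biUnion hN hZd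
  have hd : ∀ f ∈ M, ∀ g ∈ univ.biUnion N, ∀ i, f i ≠ g i := by
    intro f hf g hg i hfg
    obtain ⟨j, -, hj⟩ := mem_biUnion.1 (hU.mem g hg i)
    exact disjoint_left.1 (hZM j i) (cov_mem hf) (hfg ▸ hj)
  refine ⟨M ∪ univ.biUnion N, hM.union (hU.mono fun _ => subset_univ _) hd, ?_⟩
  rw [card_union_of_ne hd, hUc, sum_congr rfl fun j _ => hNc j]
  omega

lemma IsExtremal.exists_matching [NeZero k] (hk : 3 ≤ k) {d b : ℕ}
    (hnd : Fintype.card V ≤ k * d) (hd : ∀ i f, d ≤ (nbr E i f).card)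
    (h : IsExtremal E A G b (k * 2 ^ k * (2 * k) ^ k)) (hb : 1 ≤ b)
    (hC : k * 2 ^ k * (2 * k) ^ k * b ≤ Fintype.card V) :
    ∃ N, IsMatch E (fun _ => univ) N ∧ Fintype.card V ≤ N.card + 1 := by
  set n := Fintype.card V with hn
  have hk0 : 0 < k := by omega
  -- `B` bounds the total error over all classes; the three corrections use at most B, B and 2B
  -- edges.
  obtain ⟨B, hB⟩ : ∃ B, B = k * b := ⟨_, rfl⟩
  have hkB : k ≤ B := by rw [hB]; exact Nat.le_mul_of_pos_right _ hb
  have hbB : 3 * b ≤ B := by rw [hB]; exact Nat.mul_le_mul_right _ hk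
  have hn' : k * (64 * B) ≤ n := by
    refine le_trans ?_ hC
    have h1 : 8 ≤ 2 ^ k := by
      calc 8 = 2 ^ 3 := by norm_num
        _ ≤ 2 ^ k := Nat.pow_le_pow_right (by norm_num) hk
    have h2 : 8 * k ≤ (2 * k) ^ k := by
      calc 8 * k ≤ 8 * k ^ 3 := Nat.mul_le_mul_left _ (Nat.le_self_pow (by norm_num) k)
        _ = (2 * k) ^ 3 := by ring
        _ ≤ (2 * k) ^ k := Nat.pow_le_pow_right (by omega) hk
    calc k * (64 * B) = k * 8 * (8 * k) * b := by rw [hB]; ring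
      _ ≤ k * 2 ^ k * (2 * k) ^ k * b :=
        Nat.mul_le_mul_right _ (Nat.mul_le_mul (Nat.mul_le_mul_left _ h1) h2)
  have h64 : 192 * B ≤ n := by
    have := Nat.mul_le_mul_right (64 * B) hk
    omega
  have hdB : 64 * B ≤ d := Nat.le_of_mul_le_mul_left (hn'.trans hnd) hk0
  have hAB : ∀ i, 64 * B ≤ (A i).card + b := fun i =>
    Nat.le_of_mul_le_mul_left (hn'.trans (h.le_A i)) hk0
  have hA3 : ∀ i, 3 * (A i).card ≤ n + 3 * b := by
    intro i
    by_contra hcon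
    have h1 := h.A_le i
    obtain ⟨c, hc⟩ : ∃ c, (A i).card = b + c := ⟨(A i).card - b, by omega⟩
    have h2 : k * (A i).card = k * b + k * c := by rw [hc]; ring
    have h3 : 3 * c ≤ k * c := Nat.mul_le_mul_right _ hk
    omega
  have hGB : ∀ i, 60 * B ≤ (G i).card := by
    intro i
    have h1 := h.le_AG i
    have h2 := hA3 i
    omega
  have hYb : ∀ i, ((A i ∪ G i)ᶜ).card ≤ b := by
    intro i
    rw [card_compl, card_union_of_disjoint (h.disj i)]
    have := h.le_AG i
    omega
  have hsum1 : n ≤ ∑ i, (A i).card + B := by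
    have h1 : ∑ _i : Fin k, n ≤ ∑ i, k * ((A i).card + b) := sum_le_sum fun i _ => h.le_A i
    rw [← mul_sum, sum_const, card_univ, Fintype.card_fin, smul_eq_mul, sum_add_distrib,
      sum_const, card_univ, Fintype.card_fin, smul_eq_mul, ← hB] at h1
    exact Nat.le_of_mul_le_mul_left h1 hk0
  have hsum2 : ∑ i, (A i).card ≤ n + B := by
    have h1 : ∑ i, k * (A i).card ≤ ∑ _i : Fin k, (n + k * b) := sum_le_sum fun i _ => h.A_le i
    rw [← mul_sum, sum_const, card_univ, Fintype.card_fin, smul_eq_mul, ← hB] at h1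
    exact Nat.le_of_mul_le_mul_left h1 hk0
  -- Truncated subtraction: edges avoiding `A` are needed only if `A` is too small, and `s` of them
  -- make the surplus nonnegative.
  obtain ⟨s, hs⟩ : ∃ s, s = n - ∑ i, (A i).card := ⟨_, rfl⟩
  obtain ⟨M₀, hM₀, hM₀c⟩ := exists_isMatch_compl (s := s) hd A (by
      have h1 : ∑ _i : Fin k, d ≤ ∑ i, ((d - (A i).card) + (A i).card) :=
        sum_le_sum fun i _ => by omega
      rw [sum_const, card_univ, Fintype.card_fin, smul_eq_mul, sum_add_distrib] at h1
      omega) (by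
      intro i
      have h1 := hA3 i
      rw [card_compl]
      omega)
  have hex₀ : excess A M₀ = s := by
    have h1 : ∀ f ∈ M₀, (1 - (hits A f : ℤ)) = 1 := by
      intro f hf
      have : hits A f = 0 := by
        rw [hits, card_eq_zero, filter_eq_empty_iff]
        exact fun i _ => mem_compl.1 (hM₀.mem f hf i)
      rw [this]; simp
    rw [excess, sum_congr rfl h1]; simp [hM₀c]
  obtain ⟨M₁, hM₁, hY₁, hM₁c, he1, he2⟩ := exists_cover_exceptional hk hd h.disj hYb B M₀
    (hM₀.mono fun _ => subset_univ _) (by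
      calc _ ≤ ∑ _i : Fin k, b := sum_le_sum fun i _ => (card_le_card sdiff_subset).trans (hYb i)
        _ = B := by simp [hB]) (by omega) (fun i => by have := hGB i; omega)
  have hcast : ∑ i, ((A i).card : ℤ) = ((∑ i, (A i).card : ℕ) : ℤ) := by push_cast; rfl
  obtain ⟨M₂, hM₂, hY₂, hM₂c, he3, he4⟩ := exists_reduce_excess (A := A) hk hd
    (∑ i, ((A i).card : ℤ) - n) (fun i => (A i ∪ G i)ᶜ) (2 * B) M₁ hM₁ hY₁ (by omega)
    (by push_cast; omega) (by omega) (fun i => by have := hAB i; omega)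
  refine h.exists_extension hk hb hC hM₂ hY₂ he3 he4 (fun i => ?_) (fun i => ?_) fun i => ?_
  · have h1 : n ≤ k * (A i).card + B := by
      have := h.le_A i
      rwa [Nat.mul_add, ← hB] at this
    have h2 : 2 * k * (M₂.card + 1) ≤ 2 * k * (5 * B) := Nat.mul_le_mul_left _ (by omega)
    have h3 : 2 * k * (5 * B) = 10 * (k * B) := by ring
    have h4 : 2 * k * (A i).card = 2 * (k * (A i).card) := by ring
    have h5 : k * (64 * B) = 64 * (k * B) := by ring
    have h6 : B ≤ k * B := Nat.le_mul_of_pos_left _ hk0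
    omega
  · have := hAB i
    omega
  · have := hGB i
    omega

end

/-! ### Choice of parameters and assembly of part (i). -/

/-- With t about n / D, the exponential (q / (q-1))^t beats n^(2k), the bound for the number of
pairs of tuples. -/
lemma exists_pow_mul_lt_pow (q D k : ℕ) (hq : 1 ≤ q) (hD : 1 ≤ D) :
    ∃ n₀ : ℕ, ∀ n, n₀ ≤ n → ∃ t, D * (t + 1) ≤ n ∧ (q - 1) ^ t * (n ^ k * n ^ k) < q ^ t := by
  have hq0 : (0 : ℝ) < q := by exact_mod_cast hq
  have hr : |((q - 1 : ℕ) : ℝ) / q| < 1 := by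
    rw [abs_of_nonneg (by positivity), div_lt_one hq0]
    exact_mod_cast Nat.sub_lt hq one_pos
  have hlim := tendsto_pow_const_mul_const_pow_of_abs_lt_one (2 * k) hr
  have hε : (0 : ℝ) < 1 / (3 * D) ^ (2 * k) := by positivity
  obtain ⟨t₀, ht₀⟩ := Filter.eventually_atTop.1 (hlim.eventually (gt_mem_nhds hε))
  refine ⟨D * (t₀ + 2), fun n hn => ⟨n / D - 1, ?_, ?_⟩⟩
  · have h1 : t₀ + 2 ≤ n / D := (Nat.le_div_iff_mul_le hD).2 (by rwa [mul_comm])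
    rw [Nat.sub_add_cancel (by omega)]
    exact Nat.mul_div_le n D
  · have h1 : t₀ + 2 ≤ n / D := (Nat.le_div_iff_mul_le hD).2 (by rwa [mul_comm])
    obtain ⟨t, ht⟩ : ∃ t, t = n / D - 1 := ⟨_, rfl⟩
    rw [← ht]
    have h2 : n ≤ 3 * D * t := by
      have h3 := Nat.lt_mul_div_succ n hD
      have h4 : D * (n / D + 1) ≤ D * (3 * t) := Nat.mul_le_mul_left _ (by omega)
      have h5 : D * (3 * t) = 3 * D * t := by ring
      omega
    have h3 := ht₀ t (by omega)
    rw [div_pow, lt_div_iff₀ (by positivity)] at h3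
    have hqt : (0 : ℝ) < (q : ℝ) ^ t := by positivity
    have h4 : ((q - 1 : ℕ) : ℝ) ^ t * ((n : ℝ) ^ k * (n : ℝ) ^ k) < (q : ℝ) ^ t := by
      have h5 : (n : ℝ) ^ (2 * k) ≤ (3 * D) ^ (2 * k) * (t : ℝ) ^ (2 * k) := by
        rw [← mul_pow]
        exact pow_le_pow_left₀ (by positivity) (by exact_mod_cast h2) _
      calc ((q - 1 : ℕ) : ℝ) ^ t * ((n : ℝ) ^ k * (n : ℝ) ^ k)
          = ((q - 1 : ℕ) : ℝ) ^ t * (n : ℝ) ^ (2 * k) := by ring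
        _ ≤ ((q - 1 : ℕ) : ℝ) ^ t * ((3 * D) ^ (2 * k) * (t : ℝ) ^ (2 * k)) := by gcongr
        _ = ((t : ℝ) ^ (2 * k) * (((q - 1 : ℕ) : ℝ) ^ t / (q : ℝ) ^ t) *
              (3 * D) ^ (2 * k)) * (q : ℝ) ^ t := by field_simp
        _ < 1 * (q : ℝ) ^ t := by gcongr
        _ = (q : ℝ) ^ t := one_mul _
    exact_mod_cast h4

/-- A large balanced `k`-partite `k`-graph with codegrees at least `n / k` has a matching of
size `n - 1`. -/
theorem exists_near_perfect_matching (k : ℕ) (hk : 3 ≤ k) :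
    ∃ n₀ : ℕ, ∀ n, n₀ ≤ n → ∀ E : Finset (Fin k → Fin n), (∀ i f, n ≤ k * (nbr E i f).card) →
      ∃ N, IsMatch E (fun _ => univ) N ∧ n ≤ N.card + 1 := by
  classical
  have : NeZero k := ⟨by omega⟩
  obtain ⟨C, hC⟩ : ∃ C, C = k * 2 ^ k * (2 * k) ^ k := ⟨_, rfl⟩
  -- The first summand makes the final error of the extremal structure at most n / C, the second
  -- leaves room for choosing k² rounds of absorbers.
  obtain ⟨D, hD⟩ : ∃ D, D = C * (2 * C + 2) * ((k ^ 3 + k + 1) * (k * k) + k) +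
    2 * k ^ 4 * (k * k + 2) := ⟨_, rfl⟩
  have hk4 : 1 ≤ k ^ 4 := Nat.one_le_iff_ne_zero.2 (by positivity)
  have hk3 : 1 ≤ k ^ 3 := Nat.one_le_iff_ne_zero.2 (by positivity)
  have hD1 : 1 ≤ D := by
    have : 1 * 1 ≤ 2 * k ^ 4 * (k * k + 2) := Nat.mul_le_mul (by omega) (by omega)
    omega
  obtain ⟨n₀, hn₀⟩ := exists_pow_mul_lt_pow (2 * k ^ 3) D k (by omega) hD1
  refine ⟨n₀, fun n hn E hE => ?_⟩
  obtain ⟨t, htD, ht⟩ := hn₀ n hn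
  have hn0 : 0 < n := lt_of_lt_of_le (Nat.mul_pos hD1 (Nat.succ_pos t)) htD
  have hk0 : 0 < k := by omega
  have hV : Fintype.card (Fin n) = n := Fintype.card_fin n
  have hmul : ∀ c c' : ℕ, c * t + c' ≤ (c + c') * (t + 1) := fun c c' => by nlinarith
  have hD2 : 2 * k ^ 4 * (k * k * t + 2) ≤ n := by
    calc 2 * k ^ 4 * (k * k * t + 2) ≤ 2 * k ^ 4 * ((k * k + 2) * (t + 1)) :=
          Nat.mul_le_mul_left _ (hmul _ _)
      _ = 2 * k ^ 4 * (k * k + 2) * (t + 1) := by ring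
      _ ≤ D * (t + 1) := Nat.mul_le_mul_right _ (by omega)
      _ ≤ n := htD
  have hD3 : C * ((2 * C + 2) * ((k ^ 3 + k + 1) * (k * k * t) + k)) ≤ n := by
    calc C * ((2 * C + 2) * ((k ^ 3 + k + 1) * (k * k * t) + k))
        = C * (2 * C + 2) * ((k ^ 3 + k + 1) * (k * k) * t + k) := by ring
      _ ≤ C * (2 * C + 2) * (((k ^ 3 + k + 1) * (k * k) + k) * (t + 1)) :=
          Nat.mul_le_mul_left _ (hmul _ _)
      _ = C * (2 * C + 2) * ((k ^ 3 + k + 1) * (k * k) + k) * (t + 1) := by ring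
      _ ≤ D * (t + 1) := Nat.mul_le_mul_right _ (by omega)
      _ ≤ n := htD
  obtain ⟨F, hF, hFc, hFa⟩ := exists_absorbing (E := E) hk (by simpa using hE) t
    (by simpa using ht) (k * k) (by simpa using hD2)
  obtain ⟨M, hM⟩ := exists_isMaxMatch E fun i => (cov F i)ᶜ
  by_cases hbig : n ≤ F.card + M.card + 1 + k * k
  · have := exists_large_of_absorbing (k * k) F M hF (hM.1.mono fun _ => subset_univ _)
      (fun f hf g hg i hfg => mem_compl.1 (hM.1.mem g hg i) (hfg ▸ cov_mem hf)) hFa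
      (by simpa using hbig)
    simpa using this
  -- `d` is n / k rounded up.
  obtain ⟨d, hd⟩ : ∃ d, d = (n + (k - 1)) / k := ⟨_, rfl⟩
  have hnd : n ≤ k * d := by
    have := Nat.lt_mul_div_succ (n + (k - 1)) hk0
    rw [← hd, Nat.mul_add] at this
    omega
  have hdn : k * d ≤ n + k := by
    have := Nat.mul_div_le (n + (k - 1)) k
    rw [← hd] at this
    omega
  have hdE : ∀ i f, d ≤ (nbr E i f).card := by
    intro i f
    rw [hd, ← Nat.lt_succ_iff, Nat.div_lt_iff_lt_mul hk0]
    have := hE i f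
    rw [Nat.succ_mul, mul_comm]
    omega
  obtain ⟨A, G, h1, h2, h3, h4, h5⟩ := exists_extremal_partition (d := d) (φ := k * k * t)
    (by simpa using hnd) (by simpa using hdn) hdE
    (fun i => by rw [compl_compl]; exact (card_cov_le F i).trans hFc) hM (fun i => by
      have h6 := le_card_sdiff (cov M i) (cov F i)ᶜ
      have h7 := card_cov_le M i
      have h8 := card_cov_le F i
      rw [card_compl, hV] at h6
      omega)
  obtain ⟨A', hA'⟩ := exists_isExtremal C (by simpa using hn0) (by simpa using hnd) hdE
    h1 h2 h3 h4 h5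
  have := (hC ▸ hA').exists_matching hk (by simpa using hnd) hdE
    (by
      have : 1 * 1 ≤ (2 * C + 2) * ((k ^ 3 + k + 1) * (k * k * t) + k) :=
        Nat.mul_le_mul (by omega) (by omega)
      simpa [← hC] using this)
    (by rw [hV]; simpa [← hC] using hD3)
  simpa using this

/-! ### Transfer from tuples to hypergraphs. -/

/-- Disjoint edges meet class 0 in distinct vertices. Boundedness is needed since `matchingNumber`
is a supremum in ℕ, which is 0 on unbounded sets. -/
lemma bddAbove_matching {α : Type*} {k n : ℕ} [NeZero k] {H : Hypergraph α} {P : Fin k → Set α}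
    (hP : H.IsPartiteWith P) (hn : ∀ i, (P i).encard = n) :
    ∀ m ∈ {m : ℕ | ∃ M : Set (Set α), H.IsMatching M ∧ M.encard = m}, m ≤ n := by
  rintro m ⟨M, hM, hMm⟩
  have h1 : ∀ e : M, ∃ x, x ∈ e.1 ∩ P 0 := fun e => by
    change (e.1 ∩ P 0).Nonempty
    rw [← Set.encard_pos, hP.encard_inter e (hM.1 e.2)]; exact one_pos
  choose x hx using h1
  have h3 : M.encard ≤ (P 0).encard := by
    refine Embedding.encard_le ⟨fun e => ⟨x e, (hx e).2⟩, fun e e' hee => ?_⟩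
    have hxx : x e = x e' := congrArg Subtype.val hee
    by_contra hne
    exact Set.disjoint_left.1 (hM.2 e e.2 e' e'.2 fun h => hne (Subtype.ext h)) (hx e).1
      (hxx ▸ (hx e').1)
  rw [hMm, hn 0] at h3
  exact_mod_cast h3

theorem pred_le_matchingNumber (k : ℕ) (hk : 3 ≤ k) :
    ∃ n₀ : ℕ, ∀ n : ℕ, n₀ ≤ n →
      ∀ (α : Type*) (H : Hypergraph α) (P : Fin k → Set α),
        H.IsPartiteWith P → (∀ i, (P i).encard = n) →
        (n : ℝ) / (k : ℝ) ≤ (H.minCodegree P : ℝ) →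
        (n : ℤ) - 1 ≤ (H.matchingNumber : ℤ) := by
  classical
  have : NeZero k := ⟨by omega⟩
  obtain ⟨n₀, hn₀⟩ := exists_near_perfect_matching k hk
  refine ⟨n₀, fun n hn α H P hP hPn hdeg => ?_⟩
  have hcard : ∀ i, Nat.card (P i) = n := fun i => by
    rw [Nat.card_coe_set_eq, Set.ncard, hPn i]; rfl
  have hfin : ∀ i, Finite (P i) := fun i => Set.finite_of_encard_eq_coe (hPn i)
  let φ : ∀ i, Fin n ≃ P i := fun i => (Finite.equivFinOfCardEq (hcard i)).symm
  let v : Fin k → Fin n → α := fun i x => φ i x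
  have hvP : ∀ i x, v i x ∈ P i := fun i x => (φ i x).2
  have hvclass : ∀ i j x, v i x ∈ P j → i = j := by
    intro i j x hx
    by_contra hij
    exact Set.disjoint_left.1 (hP.disjoint i j hij) (hvP i x) hx
  have hvinj : ∀ i x y, v i x = v i y → x = y := fun i x y h =>
    (φ i).injective (Subtype.ext h)
  let edge : (Fin k → Fin n) → Set α := fun f => Set.range fun i => v i (f i)
  have hmemedge : ∀ f i x, v i x ∈ edge f → f i = x := by
    rintro f i x ⟨j, hj⟩
    have hji : j = i := hvclass j i (f j) (by
      have h : v j (f j) = v i x := hj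
      rw [h]; exact hvP i x)
    subst hji
    exact hvinj j _ _ hj
  have hedgeinj : Injective edge := fun f g hfg => by
    funext i
    exact (hmemedge g i (f i) (hfg ▸ ⟨i, rfl⟩)).symm
  let E : Finset (Fin k → Fin n) := univ.filter fun f => edge f ∈ H.edgeSet
  have hnbr : ∀ i f, n ≤ k * (nbr E i f).card := by
    intro i f
    let S : Set α := (fun l => v l (f l)) '' {i}ᶜ
    have hSP : ∀ l, S ∩ P l ⊆ {v l (f l)} := by
      rintro l y ⟨⟨j, -, rfl⟩, hy⟩
      obtain rfl := hvclass j l _ hy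
      rfl
    have hSi : ∀ y ∈ S, y ∉ P i := by
      rintro y ⟨j, hj, rfl⟩ hy
      exact hj (hvclass j i _ hy)
    have hlegal : H.IsLegal P S := by
      refine ⟨?_, fun l => (Set.encard_le_encard (hSP l)).trans (Set.encard_singleton _).le⟩
      rintro y ⟨j, -, rfl⟩
      rw [← hP.iUnion_eq]
      exact Set.mem_iUnion.2 ⟨j, hvP j _⟩
    have hScard : S.encard = ((k - 1 : ℕ) : ℕ∞) := by
      rw [Set.InjOn.encard_image]
      · rw [← coe_singleton, ← coe_compl, Set.encard_coe_eq_coe_finsetCard, card_compl]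
        simp
      · intro a _ b _ hab
        exact hvclass a b (f a) (by
          have h : v a (f a) = v b (f b) := hab
          rw [h]; exact hvP b _)
    have h1 : H.minCodegree P ≤ H.setDegree k S :=
      Nat.sInf_le ⟨S, hlegal, hScard, rfl⟩
    -- A set completing `S` is a single vertex, and it lies in class `i` because the edge must meet
    -- that class and `S` does not.
    have h2 : H.neighborhood k S ⊆ (fun x => {v i x}) '' (nbr E i f : Set (Fin n)) := by
      rintro U ⟨-, hU, hSU⟩
      have hU1 : U.encard = 1 := by
        rw [hScard] at hU
        have h3 : (k : ℕ∞) = ((k - 1 : ℕ) : ℕ∞) + 1 := by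
          have : ((k - 1 + 1 : ℕ) : ℕ∞) = k := by congr 1; omega
          rw [← this]; push_cast; rfl
        rw [h3] at hU
        exact ENat.add_right_injective_of_ne_top (ENat.natCast_ne_top _) hU
      obtain ⟨u, rfl⟩ := Set.encard_eq_one.1 hU1
      obtain ⟨w, hw, hwP⟩ : ((S ∪ {u}) ∩ P i).Nonempty := by
        rw [← Set.encard_pos, hP.encard_inter _ hSU]; exact one_pos
      have huP : u ∈ P i := by
        rcases hw with hw | hw
        · exact absurd hwP (hSi w hw)
        · rwa [← Set.mem_singleton_iff.1 hw]
      obtain ⟨x, hx⟩ := (φ i).surjective ⟨u, huP⟩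
      have hxu : v i x = u := congrArg Subtype.val hx
      refine ⟨x, ?_, by simp [hxu]⟩
      rw [mem_coe, mem_nbr, mem_filter]
      refine ⟨mem_univ _, ?_⟩
      convert hSU using 1
      ext y
      constructor
      · rintro ⟨l, rfl⟩
        by_cases hl : l = i
        · subst hl; right; simp [hxu]
        · left; exact ⟨l, hl, by simp [hl]⟩
      · rintro (⟨l, hl, rfl⟩ | hy)
        · exact ⟨l, by simp [Set.mem_compl_singleton_iff.1 hl]⟩
        · exact ⟨i, by simp [hxu, Set.mem_singleton_iff.1 hy]⟩
    have h3 : H.setDegree k S ≤ (nbr E i f).card := by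
      refine (Set.ncard_le_ncard h2 ((finite_toSet _).image _)).trans ?_
      refine (Set.ncard_image_le (finite_toSet _)).trans ?_
      rw [Set.ncard_coe_finset]
    have hk0 : (0 : ℝ) < k := by exact_mod_cast (show 0 < k by omega)
    rw [div_le_iff₀ hk0] at hdeg
    have h4 : n ≤ H.minCodegree P * k := by exact_mod_cast hdeg
    rw [mul_comm]
    exact h4.trans (Nat.mul_le_mul_right _ (h1.trans h3))
  obtain ⟨N, hN, hNc⟩ := hn₀ n hn E hnbr
  have hle : N.card ≤ H.matchingNumber := by
    refine le_csSup ⟨n, bddAbove_matching hP hPn⟩ ⟨edge '' (N : Set (Fin k → Fin n)), ⟨?_, ?_⟩, ?_⟩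
    · rintro e ⟨f, hf, rfl⟩
      exact (mem_filter.1 (hN.sub hf)).2
    · rintro e ⟨f, hf, rfl⟩ e' ⟨g, hg, rfl⟩ hne
      rw [Set.disjoint_left]
      rintro y ⟨i, rfl⟩ hy
      refine hne ?_
      rw [hN.inj g hg f hf i (hmemedge g i _ hy)]
    · rw [hedgeinj.encard_image, Set.encard_coe_eq_coe_finsetCard]
  omega

/-! ### The space barrier, for part (ii). -/

/-- The `k`-partite `k`-graph with classes of size `n` whose edges are the transversals which
meet the first `a` vertices of some class. -/
def spaceBarrier (k n a : ℕ) : Hypergraph (Fin k × Fin n) where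
  vertexSet := Set.univ
  edgeSet := {e | ∃ f : Fin k → Fin n, (∃ i, (f i).val < a) ∧ e = Set.range fun i => (i, f i)}
  subset_vertexSet_of_mem_edgeSet' := fun _ _ => Set.subset_univ _

/-- The `i`-th class of `spaceBarrier`. -/
def barrierClass (k n : ℕ) (i : Fin k) : Set (Fin k × Fin n) := {p | p.1 = i}

lemma encard_barrierClass (k n : ℕ) (i : Fin k) : (barrierClass k n i).encard = n := by
  have : barrierClass k n i = (fun x => (i, x)) '' (Set.univ : Set (Fin n)) := by
    ext ⟨j, x⟩
    simp [barrierClass, eq_comm]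
  rw [this, Injective.encard_image (Prod.mk_right_injective i)]
  simp

lemma range_inter_barrierClass {k n : ℕ} (f : Fin k → Fin n) (i : Fin k) :
    (Set.range fun i => (i, f i)) ∩ barrierClass k n i = {(i, f i)} := by
  ext ⟨j, x⟩
  simp only [barrierClass, Set.mem_inter_iff, Set.mem_range, Prod.mk.injEq,
    Set.mem_singleton_iff]
  constructor
  · rintro ⟨⟨l, rfl, rfl⟩, h⟩
    have h' : l = i := h
    subst h'; exact ⟨rfl, rfl⟩
  · rintro ⟨rfl, rfl⟩
    exact ⟨⟨j, rfl, rfl⟩, rfl⟩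

lemma spaceBarrier_isPartiteWith (k n a : ℕ) :
    (spaceBarrier k n a).IsPartiteWith (barrierClass k n) where
  disjoint i j hij := Set.disjoint_left.2 fun p hp hp' => hij (hp.symm.trans hp')
  iUnion_eq := Set.eq_univ_of_forall fun p => Set.mem_iUnion.2 ⟨p.1, rfl⟩
  encard_inter := by
    rintro e ⟨f, -, rfl⟩ i
    rw [range_inter_barrierClass, Set.encard_singleton]

lemma exists_eq_image_of_isLegal {k n a : ℕ} (hk : 1 ≤ k) (hn : 1 ≤ n)
    {S : Set (Fin k × Fin n)} (hS : (spaceBarrier k n a).IsLegal (barrierClass k n) S)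
    (hc : S.encard = ((k - 1 : ℕ) : ℕ∞)) :
    ∃ i, ∃ f : Fin k → Fin n, S = (fun l => (l, f l)) '' {i}ᶜ := by
  have hinj : Set.InjOn Prod.fst S := by
    intro p hp q hq hpq
    exact Set.encard_le_one_iff.1 (hS.2 p.1) p q ⟨hp, rfl⟩ ⟨hq, hpq.symm⟩
  have h1 : (Prod.fst '' S)ᶜ.encard = 1 := by
    have h2 := Set.encard_add_encard_compl (Prod.fst '' S)
    rw [hinj.encard_image, hc] at h2
    have h3 : (Set.univ : Set (Fin k)).encard = ((k - 1 : ℕ) : ℕ∞) + 1 := by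
      have : ((k - 1 + 1 : ℕ) : ℕ∞) = k := by congr 1; omega
      rw [Set.encard_univ, ENat.card_eq_coe_fintype_card, Fintype.card_fin, ← this]
      push_cast; rfl
    rw [h3] at h2
    exact ENat.add_right_injective_of_ne_top (ENat.natCast_ne_top _) h2
  obtain ⟨i, hi⟩ := Set.encard_eq_one.1 h1
  have h2 : ∀ l, ∃ x : Fin n, l ≠ i → (l, x) ∈ S := by
    intro l
    by_cases hl : l = i
    · exact ⟨⟨0, hn⟩, fun h => absurd hl h⟩
    · have h3 : l ∈ Prod.fst '' S := by
        by_contra hcon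
        have : l ∈ (Prod.fst '' S)ᶜ := hcon
        rw [hi] at this
        exact hl this
      obtain ⟨⟨j, x⟩, hp, rfl⟩ := h3
      exact ⟨x, fun _ => hp⟩
  choose f hf using h2
  refine ⟨i, f, Set.Subset.antisymm ?_ ?_⟩
  · intro p hp
    have hpi : p.1 ≠ i := fun h => by
      have : p.1 ∈ (Prod.fst '' S)ᶜ := by rw [hi]; exact h
      exact this ⟨p, hp, rfl⟩
    exact ⟨p.1, hpi, hinj (hf _ hpi) hp rfl⟩
  · rintro p ⟨l, hl, rfl⟩
    exact hf l hl

lemma image_union_eq_range {k n : ℕ} (f : Fin k → Fin n) (i : Fin k) (x : Fin n) :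
    ((fun l => (l, f l)) '' {i}ᶜ) ∪ {(i, x)} = Set.range fun l => (l, update f i x l) := by
  ext p
  constructor
  · rintro (⟨l, hl, rfl⟩ | hp)
    · exact ⟨l, by simp [Set.mem_compl_singleton_iff.1 hl]⟩
    · exact ⟨i, by simp [Set.mem_singleton_iff.1 hp]⟩
  · rintro ⟨l, rfl⟩
    by_cases hl : l = i
    · subst hl; right; simp
    · left; exact ⟨l, hl, by simp [hl]⟩

lemma encard_image_compl {k n : ℕ} (f : Fin k → Fin n) (i : Fin k) :
    ((fun l => (l, f l)) '' {i}ᶜ).encard = ((k - 1 : ℕ) : ℕ∞) := by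
  rw [Injective.encard_image fun a b h => congrArg Prod.fst h, ← coe_singleton, ← coe_compl,
    Set.encard_coe_eq_coe_finsetCard, card_compl]
  simp

lemma le_minCodegree_spaceBarrier {k n a : ℕ} (hk : 1 ≤ k) (hn : 1 ≤ n) (ha : a ≤ n) :
    a ≤ (spaceBarrier k n a).minCodegree (barrierClass k n) := by
  refine le_csInf ?_ ?_
  -- A legal (k-1)-set must be exhibited, since the infimum of the empty set of naturals is 0.
  · refine ⟨_, (fun l => (l, (⟨0, hn⟩ : Fin n))) '' {(⟨0, hk⟩ : Fin k)}ᶜ,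
      ⟨Set.subset_univ _, fun i => ?_⟩, encard_image_compl (fun _ => ⟨0, hn⟩) _, rfl⟩
    refine (Set.encard_le_encard (Set.inter_subset_inter_left _ (Set.image_subset_range _ _))).trans
      ?_
    rw [range_inter_barrierClass fun _ => (⟨0, hn⟩ : Fin n), Set.encard_singleton]
  · rintro d ⟨S, hS, hSc, rfl⟩
    obtain ⟨i, f, rfl⟩ := exists_eq_image_of_isLegal hk hn hS hSc
    have h1 : (fun x : Fin n => ({(i, x)} : Set (Fin k × Fin n))) '' {x | x.val < a} ⊆
        (spaceBarrier k n a).neighborhood k ((fun l => (l, f l)) '' {i}ᶜ) := by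
      rintro U ⟨x, hx, rfl⟩
      refine ⟨Set.subset_univ _, ?_, update f i x, ⟨i, by simpa using hx⟩,
        image_union_eq_range f i x⟩
      rw [hSc, Set.encard_singleton]
      have : ((k - 1 + 1 : ℕ) : ℕ∞) = k := by congr 1; omega
      rw [← this]; push_cast; rfl
    have h2 := Set.ncard_le_ncard h1 (Set.toFinite _)
    rw [Set.ncard_image_of_injective _ fun x y h => by simpa using h] at h2
    refine le_trans (le_of_eq ?_) h2
    have h3 : {x : Fin n | x.val < a} = ((univ.filter fun x : Fin n => x.val < a) : Set _) := by
      ext; simp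
    rw [h3, Set.ncard_coe_finset, Fin.card_filter_val_lt]
    omega

/-- Disjoint edges contain distinct vertices among the `k * a` vertices of the barrier. -/
lemma matchingNumber_spaceBarrier_le (k n a : ℕ) :
    (spaceBarrier k n a).matchingNumber ≤ k * a := by
  refine csSup_le ⟨0, ∅, ⟨by simp, by simp⟩, by simp⟩ ?_
  rintro m ⟨M, hM, hMm⟩
  have h1 : ∀ e : M, ∃ p : Fin k × Fin n, p ∈ e.1 ∧ p.2.val < a := by
    rintro ⟨e, he⟩
    obtain ⟨f, ⟨i, hi⟩, rfl⟩ := hM.1 he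
    exact ⟨(i, f i), ⟨i, rfl⟩, hi⟩
  choose x hx hxa using h1
  let y : M → Fin k × Fin a := fun e => ((x e).1, ⟨(x e).2.val, hxa e⟩)
  have hy : Injective y := by
    intro e e' hee
    simp only [y, Prod.mk.injEq, Fin.mk.injEq] at hee
    have hxx : x e = x e' := Prod.ext hee.1 (Fin.ext hee.2)
    by_contra hne
    exact Set.disjoint_left.1 (hM.2 e e.2 e' e'.2 fun h => hne (Subtype.ext h)) (hx e)
      (hxx ▸ hx e')
  have h2 := Nat.card_le_card_of_injective y hy
  rw [Nat.card_coe_set_eq, Set.ncard, hMm] at h2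
  simpa using h2

end KPartite

theorem theorem1 (k : ℕ) (hk : 3 ≤ k) :
    (∃ n₀ : ℕ, ∀ n : ℕ, n₀ ≤ n →
      ∀ (α : Type*) (H : Hypergraph α) (P : Fin k → Set α),
        H.IsPartiteWith P → (∀ i, (P i).encard = n) →
        (n : ℝ) / (k : ℝ) ≤ (H.minCodegree P : ℝ) →
        (n : ℤ) - 1 ≤ (H.matchingNumber : ℤ)) ∧
    (∀ n : ℕ, 1 ≤ n → ¬ n ≡ 1 [MOD k] →
      ∃ (α : Type) (H : Hypergraph α) (P : Fin k → Set α),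
        H.IsPartiteWith P ∧ (∀ i, (P i).encard = n) ∧
        ⌊((n : ℝ) - 1) / (k : ℝ)⌋ ≤ (H.minCodegree P : ℤ) ∧
        (H.matchingNumber : ℤ) < (n : ℤ) - 1) := by
  refine ⟨KPartite.pred_le_matchingNumber k hk, fun n hn hmod => ?_⟩
  have hk0 : 0 < k := by omega
  obtain ⟨a, ha⟩ : ∃ a, a = (n - 1) / k := ⟨_, rfl⟩
  have hka : k * a ≤ n - 1 := ha ▸ Nat.mul_div_le _ _
  have han : a ≤ n := by
    have := Nat.div_le_self (n - 1) k
    omega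
  refine ⟨Fin k × Fin n, KPartite.spaceBarrier k n a, KPartite.barrierClass k n,
    KPartite.spaceBarrier_isPartiteWith k n a, KPartite.encard_barrierClass k n, ?_, ?_⟩
  · have h1 := KPartite.le_minCodegree_spaceBarrier (k := k) hk0 hn han
    have h2 : ⌊((n : ℝ) - 1) / (k : ℝ)⌋ < (a : ℤ) + 1 := by
      rw [Int.floor_lt, div_lt_iff₀ (by exact_mod_cast hk0)]
      have h3 : n - 1 < k * (a + 1) := ha ▸ Nat.lt_mul_div_succ _ hk0
      have h4 : n < (a + 1) * k + 1 := by rw [mul_comm]; omega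
      have h5 : (n : ℝ) < (a + 1) * k + 1 := by exact_mod_cast h4
      push_cast
      linarith
    omega
  · have h1 := KPartite.matchingNumber_spaceBarrier_le k n a
    -- Equality is exactly the excluded residue n ≡ 1 mod k.
    have h2 : k * a ≠ n - 1 := fun h =>
      hmod ((Nat.modEq_iff_dvd' hn).2 ⟨a, h.symm⟩).symm
    omega
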